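/- **Setting.** Let $\mathbb T^3=(\mathbb R/2\pi\mathbb Z)^3$ and, for a distribution $u$ on $\mathbb T^3$ and $k\in\mathbb Z^3$, let $\hat u(k)=\langle u,e_{-k}\rangle$ with $e_k(x)=(2\pi)^{-3/2}e^{\imath k\cdot x}$. Let $(\chi,\theta)$ be a dyadic partition of unity on $\mathbb R^3$: $\chi,\theta$ are nonnegative, radial, smooth and compactly supported, $\operatorname{supp}\theta$ is contained in an annulus, $\chi(z)+\sum_{j\ge0}\theta(2^{-j}z)=1$ for all $z$, $\operatorname{supp}\chi\cap\operatorname{supp}\theta(2^{-j}\cdot)=\emptyset$ for $j\ge1$, and $\operatorname{supp}\theta(2^{-i}\cdot)\cap\operatorname{supp}\theta(2^{-j}\cdot)=\emptyset$ for $|i-j|>1$. Let $\Delta_{-1}u=\sum_k\chi(k)\hat u(k)e_k$, $\Delta_ju=\sum_k\theta(2^{-j}k)\hat u(k)e_k$ for $j\ge0$, and for a vector $u=(u^1,\dots,u^d)$ of distributions on $\mathbb T^3$ and $\alpha\in\mathbb R$ let $$\|u\|_\alpha=\sum_{i=1}^d\ \sup_{j\ge-1}2^{j\alpha}\|\Delta_ju^i\|_{L^\infty},\qquad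 \mathcal C^\alpha=\{u:\|u\|_\alpha<\infty\}.$$ Let $L_0>0$ and let $\tilde f:\mathbb R^3\to[0,\infty)$ be even, with $\tilde f(0)=1$, continuous at $0$, and such that on the cube $\{|x^i|<3L_0,\ i=1,2,3\}$ one has $\tilde f\ge c_f$ for some $c_f>0$ and, away from the origin, $\tilde f$ is of class $C^5$ with $|D_m\tilde f(x)|\le C_f(|x|^{1-|m|}+1)$ for all multiindices $|m|\le5$ and some constant $C_f$. Put $f(x)=\tilde f(x)$ if $|x^i|\le L_0$ for $i=1,2,3$, and $f(x)=\infty$ otherwise. For $t>0$ and $\varepsilon\in(0,1)$ let the heat semigroup $P_t=e^{t\Delta}$ and the approximated semigroup $P_t^\varepsilon$ be defined on distributions on $\mathbb T^3$, componentwise on vectors, by $$\widehat{P_tu}(k)=e^{-t|k|^2}\hat u(k),\qquad \widehat{P^\varepsilon_tu}(k)=e^{-t|k|^2f(\varepsilon k)}\hat u(k)\qquad(e^{-\infty}=0).$$ **Lemma 3.3.** Let $\alpha\in\mathbb R$, $0<\eta<1$, $\delta\ge0$ and $\kappa>0$. There is a constant $C>0$, independent of $\varepsilon$, $t$ and $u$,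 such that for all $\varepsilon\in(0,1)$, all $t>0$ and all $u\in\mathcal C^{\alpha+\eta}$, $$\|(P^\varepsilon_t-P_t)u\|_{\alpha+\delta-\kappa}\le C\,\varepsilon^{\eta}\,t^{-\delta/2}\,\|u\|_{\alpha+\eta}.$$ -/

import Mathlib

namespace TorusBesov

open scoped ENNReal ContDiff

noncomputable section

/-! ### Test functions and distributions on the torus `(ℝ / 2πℤ)³` -/

/-- Smooth functions on the torus, seen as smooth `2πℤ³`-periodic functions on `ℝ³`. -/
def TestFunction : Submodule ℂ ((Fin 3 → ℝ) → ℂ) where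
  carrier := {φ | ContDiff ℝ ∞ φ ∧
    ∀ (x : Fin 3 → ℝ) (k : Fin 3 → ℤ), φ (fun i => x i + 2 * Real.pi * k i) = φ x}
  add_mem' := by
    rintro φ ψ ⟨hφ, hφ'⟩ ⟨hψ, hψ'⟩
    exact ⟨hφ.add hψ, fun x k => by simp only [Pi.add_apply, hφ' x k, hψ' x k]⟩
  zero_mem' := ⟨contDiff_const, fun _ _ => rfl⟩
  smul_mem' := by
    rintro c φ ⟨hφ, hφ'⟩
    exact ⟨contDiff_const.smul hφ, fun x k => by simp only [Pi.smul_apply, hφ' x k]⟩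

/-- Distributions on the torus: the linear functionals on smooth functions that are continuous,
i.e. bounded by finitely many of the seminorms `sup_x ‖D^m φ(x)‖`. -/
def Distribution : Submodule ℂ (TestFunction →ₗ[ℂ] ℂ) where
  carrier := {T | ∃ (N : ℕ) (C : ℝ), ∀ (φ : TestFunction) (B : ℝ),
    (∀ m ≤ N, ∀ x, ‖iteratedFDeriv ℝ m (φ : (Fin 3 → ℝ) → ℂ) x‖ ≤ B) → ‖T φ‖ ≤ C * B}
  add_mem' := by
    rintro S T ⟨N, C, hS⟩ ⟨M, D, hT⟩
    refine ⟨max N M, C + D, fun φ B h => ?_⟩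
    rw [LinearMap.add_apply, add_mul]
    exact (norm_add_le _ _).trans (add_le_add
      (hS φ B fun m hm => h m (hm.trans (le_max_left _ _)))
      (hT φ B fun m hm => h m (hm.trans (le_max_right _ _))))
  zero_mem' := ⟨0, 0, fun φ B _ => by simp⟩
  smul_mem' := by
    rintro c T ⟨N, C, hT⟩
    refine ⟨N, ‖c‖ * C, fun φ B h => ?_⟩
    rw [LinearMap.smul_apply, norm_smul, mul_assoc]
    exact mul_le_mul_of_nonneg_left (hT φ B h) (norm_nonneg _)

/-! ### Fourier coefficients -/

/-- The linear form `x ↦ ι k · x`. -/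
def phase (k : Fin 3 → ℤ) : (Fin 3 → ℝ) →L[ℝ] ℂ :=
  ∑ i, ((k i : ℂ) * Complex.I) •
    (Complex.ofRealCLM.comp (ContinuousLinearMap.proj (R := ℝ) (φ := fun _ : Fin 3 => ℝ) i))

/-- The function `e_k(x) = (2π)^{-3/2} exp(ι k · x)`. -/
def expFun (k : Fin 3 → ℤ) (x : Fin 3 → ℝ) : ℂ :=
  (((2 * Real.pi) ^ (-(3 / 2) : ℝ) : ℝ) : ℂ) * Complex.exp (∑ i, (k i : ℂ) * Complex.I * (x i : ℂ))

theorem phase_apply (k : Fin 3 → ℤ) (x : Fin 3 → ℝ) :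
    phase k x = ∑ i, (k i : ℂ) * Complex.I * (x i : ℂ) := by
  simp [phase]

theorem norm_phase_le (k : Fin 3 → ℤ) : ‖phase k‖ ≤ 3 * max 1 ‖k‖ := by
  refine ContinuousLinearMap.opNorm_le_bound _ (by positivity) fun x => ?_
  rw [phase_apply]
  refine (norm_sum_le _ _).trans ?_
  have : ∀ i ∈ (Finset.univ : Finset (Fin 3)),
      ‖(k i : ℂ) * Complex.I * (x i : ℂ)‖ ≤ max 1 ‖k‖ * ‖x‖ := fun i _ => by
    rw [norm_mul, norm_mul, Complex.norm_I, mul_one, Complex.norm_real, Complex.norm_intCast]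
    have h1 : |(k i : ℝ)| ≤ ‖k‖ := by
      simpa [Int.norm_eq_abs] using norm_le_pi_norm k i
    exact mul_le_mul (h1.trans (le_max_right _ _)) (norm_le_pi_norm x i) (norm_nonneg _)
      (by positivity)
  refine (Finset.sum_le_sum this).trans (le_of_eq ?_)
  simp; ring

theorem contDiff_expFun (k : Fin 3 → ℤ) : ContDiff ℝ ∞ (expFun k) := by
  unfold expFun
  simp_rw [← phase_apply]
  exact contDiff_const.mul (Complex.contDiff_exp.comp (phase k).contDiff)

theorem expFun_periodic (k : Fin 3 → ℤ) (x : Fin 3 → ℝ) (l : Fin 3 → ℤ) :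
    expFun k (fun i => x i + 2 * Real.pi * l i) = expFun k x := by
  unfold expFun
  congr 1
  rw [Complex.exp_eq_exp_iff_exists_int]
  refine ⟨∑ i, k i * l i, ?_⟩
  push_cast
  rw [Finset.sum_mul, ← Finset.sum_add_distrib]
  refine Finset.sum_congr rfl fun i _ => ?_
  ring

/-- `e_k` as a test function. -/
def expTest (k : Fin 3 → ℤ) : TestFunction := ⟨expFun k, contDiff_expFun k, expFun_periodic k⟩

/-- The Fourier coefficient `û(k) = ⟨u, e_{-k}⟩` of a distribution. -/
def fourierCoeff (u : Distribution) (k : Fin 3 → ℤ) : ℂ :=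
  (u : TestFunction →ₗ[ℂ] ℂ) (expTest (-k))

/-- A fundamental domain of the torus. -/
def torusBox : Set (Fin 3 → ℝ) := Set.Icc (fun _ => -Real.pi) (fun _ => Real.pi)

/-- The Fourier coefficient `φ̂(k) = (2π)^{-3/2} ∫ φ(x) exp(-ι k · x) dx` of a function. -/
def testCoeff (φ : (Fin 3 → ℝ) → ℂ) (k : Fin 3 → ℤ) : ℂ :=
  ∫ x in torusBox, φ x * expFun (-k) x

theorem norm_expFun (k : Fin 3 → ℤ) (x : Fin 3 → ℝ) :
    ‖expFun k x‖ = (2 * Real.pi) ^ (-(3 / 2) : ℝ) := by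
  unfold expFun
  have : (∑ i, (k i : ℂ) * Complex.I * (x i : ℂ)) =
      ((∑ i, (k i : ℝ) * x i : ℝ) : ℂ) * Complex.I := by
    push_cast
    rw [Finset.sum_mul]
    exact Finset.sum_congr rfl fun i _ => by ring
  rw [this, norm_mul, Complex.norm_exp_ofReal_mul_I, mul_one, Complex.norm_real,
    Real.norm_of_nonneg (by positivity)]

theorem expFun_const_le_one : (2 * Real.pi) ^ (-(3 / 2) : ℝ) ≤ (1 : ℝ) :=
  Real.rpow_le_one_of_one_le_of_nonpos (by linarith [Real.two_le_pi]) (by norm_num)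

theorem hasFDerivAt_expFun (k : Fin 3 → ℤ) (x : Fin 3 → ℝ) :
    HasFDerivAt (expFun k) (expFun k x • phase k) x := by
  have h : HasFDerivAt (fun y => Complex.exp (phase k y)) (Complex.exp (phase k x) • phase k) x :=
    (phase k).hasFDerivAt.cexp
  have h2 := h.const_mul (((2 * Real.pi) ^ (-(3 / 2) : ℝ) : ℝ) : ℂ)
  have h3 : (fun y => (((2 * Real.pi) ^ (-(3 / 2) : ℝ) : ℝ) : ℂ) * Complex.exp (phase k y))
      = expFun k := by
    funext y; rw [phase_apply]; rfl
  rw [h3] at h2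
  have h4 : expFun k x • phase k =
      (((2 * Real.pi) ^ (-(3 / 2) : ℝ) : ℝ) : ℂ) • Complex.exp (phase k x) • phase k := by
    rw [smul_smul, ← h3]
  rw [h4]
  exact h2

theorem norm_iteratedFDeriv_expFun_le (k : Fin 3 → ℤ) (m : ℕ) (x : Fin 3 → ℝ) :
    ‖iteratedFDeriv ℝ m (expFun k) x‖ ≤ (3 * max 1 ‖k‖) ^ m := by
  induction m generalizing x with
  | zero => rw [norm_iteratedFDeriv_zero, norm_expFun, pow_zero]; exact expFun_const_le_one
  | succ m ih =>
    rw [← norm_iteratedFDeriv_fderiv]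
    set L : ℂ →L[ℝ] ((Fin 3 → ℝ) →L[ℝ] ℂ) :=
      (ContinuousLinearMap.lsmul ℝ ℂ (E := (Fin 3 → ℝ) →L[ℝ] ℂ)).flip (phase k) with hL
    have hLn : ‖L‖ ≤ 3 * max 1 ‖k‖ := by
      refine ContinuousLinearMap.opNorm_le_bound _ (by positivity) fun z => ?_
      have : L z = z • phase k := rfl
      rw [this, norm_smul, mul_comm]
      exact mul_le_mul_of_nonneg_right (norm_phase_le k) (norm_nonneg _)
    have h : fderiv ℝ (expFun k) = L ∘ expFun k := by
      funext y
      exact (hasFDerivAt_expFun k y).fderiv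
    rw [h, pow_succ']
    exact (L.norm_iteratedFDeriv_comp_left (contDiff_expFun k).contDiffAt
      (by exact_mod_cast le_top)).trans
      (mul_le_mul hLn (ih x) (norm_nonneg _) (by positivity))

theorem integral_fderiv_eq_zero (ψ : (Fin 3 → ℝ) → ℂ) (hψ : ContDiff ℝ 1 ψ)
    (hp : ∀ (x : Fin 3 → ℝ) (k : Fin 3 → ℤ), ψ (fun i => x i + 2 * Real.pi * k i) = ψ x)
    (j : Fin 3) : ∫ x in torusBox, fderiv ℝ ψ x (Pi.single j 1) = 0 := by
  have hc : Continuous (fun x => fderiv ℝ ψ x (Pi.single j 1)) :=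
    (hψ.continuous_fderiv (by norm_num)).clm_apply continuous_const
  have key := MeasureTheory.integral_divergence_of_hasFDerivAt_off_countable'
    (fun _ => -Real.pi) (fun _ => Real.pi) (fun i => by simp; linarith [Real.pi_pos])
    (fun i x => if i = j then ψ x else 0) (fun i x => if i = j then fderiv ℝ ψ x else 0) ∅
    Set.countable_empty
    (fun i => by
      by_cases h : i = j
      · simpa [h] using hψ.continuous.continuousOn
      · simpa [h] using continuousOn_const)
    (fun x _ i => by
      by_cases h : i = j
      · simpa [h] using (hψ.differentiable (by norm_num) x).hasFDerivAt
      · simpa [h] using hasFDerivAt_const (0 : ℂ) x)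
    (by
      have : (fun x => ∑ i, (if i = j then fderiv ℝ ψ x else 0) (Pi.single i (1 : ℝ)))
          = fun x => fderiv ℝ ψ x (Pi.single j 1) := by
        funext x
        rw [Finset.sum_eq_single j] <;> simp +contextual
      rw [this]
      exact hc.continuousOn.integrableOn_Icc)
  have e1 : ∀ x, ∑ i, (if i = j then fderiv ℝ ψ x else 0) (Pi.single i (1 : ℝ))
      = fderiv ℝ ψ x (Pi.single j 1) := by
    intro x
    rw [Finset.sum_eq_single j] <;> simp +contextual
  simp only [e1] at key
  unfold torusBox
  rw [key]
  refine Finset.sum_eq_zero fun i _ => ?_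
  by_cases h : i = j
  · subst h
    simp only [if_true]
    rw [sub_eq_zero]
    congr 1
    funext x
    rw [← hp (i.insertNth (-Real.pi) x) (Pi.single i 1)]
    congr 1
    funext l
    refine Fin.succAboveCases i ?_ (fun l => ?_) l
    · simp; ring
    · simp [Fin.succAbove_ne]
  · simp [h]

/-- The directional derivative of a test function. -/
theorem mem_testFunction_deriv (φ : TestFunction) (v : Fin 3 → ℝ) :
    (fun x => fderiv ℝ (φ : (Fin 3 → ℝ) → ℂ) x v) ∈ TestFunction := by
  refine ⟨(φ.2.1.fderiv_right (m := ∞) (by simp)).clm_apply contDiff_const, fun x k => ?_⟩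
  have h : (fun y : Fin 3 → ℝ => (φ : (Fin 3 → ℝ) → ℂ) (y + fun i => 2 * Real.pi * k i))
      = (φ : (Fin 3 → ℝ) → ℂ) := by
    funext y; exact φ.2.2 y k
  have h2 := fderiv_comp_add_right (𝕜 := ℝ) (f := (φ : (Fin 3 → ℝ) → ℂ)) (x := x)
    (fun i => 2 * Real.pi * k i)
  rw [h] at h2
  simp only [h2]
  rfl

theorem norm_iteratedFDeriv_deriv_le (φ : TestFunction) (j : Fin 3) (m : ℕ) (x : Fin 3 → ℝ) :
    ‖iteratedFDeriv ℝ m (fun y => fderiv ℝ (φ : (Fin 3 → ℝ) → ℂ) y (Pi.single j 1)) x‖ ≤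
      ‖iteratedFDeriv ℝ (m + 1) (φ : (Fin 3 → ℝ) → ℂ) x‖ := by
  set L := ContinuousLinearMap.apply ℝ ℂ (Pi.single j (1 : ℝ) : Fin 3 → ℝ)
  have hL : ‖L‖ ≤ 1 := by
    refine ContinuousLinearMap.opNorm_le_bound _ zero_le_one fun A => ?_
    have : L A = A (Pi.single j 1) := rfl
    rw [this, one_mul]
    refine (A.le_opNorm _).trans (mul_le_of_le_one_right (norm_nonneg _) ?_)
    rw [Pi.norm_single]; simp
  rw [← norm_iteratedFDeriv_fderiv]
  have hc : ContDiff ℝ ∞ (fderiv ℝ (φ : (Fin 3 → ℝ) → ℂ)) := φ.2.1.fderiv_right (by simp)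
  refine (L.norm_iteratedFDeriv_comp_left (f := fderiv ℝ (φ : (Fin 3 → ℝ) → ℂ))
    hc.contDiffAt (by exact_mod_cast le_top)).trans ?_
  exact mul_le_of_le_one_left (norm_nonneg _) hL

theorem volume_torusBox : (MeasureTheory.volume torusBox).toReal = (2 * Real.pi) ^ 3 := by
  unfold torusBox
  rw [Real.volume_Icc_pi_toReal (fun i => by simp; linarith [Real.pi_pos])]
  simp; ring

theorem continuous_expFun (k : Fin 3 → ℤ) : Continuous (expFun k) := (contDiff_expFun k).continuous

theorem testCoeff_deriv (φ : TestFunction) (j : Fin 3) (k : Fin 3 → ℤ) :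
    testCoeff (fun y => fderiv ℝ (φ : (Fin 3 → ℝ) → ℂ) y (Pi.single j 1)) k =
      (k j : ℂ) * Complex.I * testCoeff φ k := by
  have hd := φ.2.1.differentiable (by simp)
  have h := integral_fderiv_eq_zero (fun x => (φ : (Fin 3 → ℝ) → ℂ) x * expFun (-k) x)
    ((φ.2.1.mul (contDiff_expFun (-k))).of_le (by exact_mod_cast le_top))
    (fun x l => by rw [φ.2.2, expFun_periodic]) j
  have e : ∀ x, fderiv ℝ (fun x => (φ : (Fin 3 → ℝ) → ℂ) x * expFun (-k) x) x (Pi.single j 1) =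
      fderiv ℝ (φ : (Fin 3 → ℝ) → ℂ) x (Pi.single j 1) * expFun (-k) x -
        (k j : ℂ) * Complex.I * ((φ : (Fin 3 → ℝ) → ℂ) x * expFun (-k) x) := by
    intro x
    have hp : phase (-k) (Pi.single j 1) = -((k j : ℂ) * Complex.I) := by
      rw [phase_apply, Finset.sum_eq_single j] <;> simp +contextual
    have hm : HasFDerivAt (fun x => (φ : (Fin 3 → ℝ) → ℂ) x * expFun (-k) x) _ x :=
      (hd x).hasFDerivAt.mul (hasFDerivAt_expFun (-k) x)
    rw [hm.fderiv]
    simp only [_root_.add_apply, _root_.smul_apply, smul_eq_mul, hp]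
    ring
  simp only [e] at h
  have c1 : Continuous fun x => fderiv ℝ (φ : (Fin 3 → ℝ) → ℂ) x (Pi.single j 1) * expFun (-k) x :=
    ((φ.2.1.continuous_fderiv (by simp)).clm_apply continuous_const).mul (continuous_expFun _)
  have c2 : Continuous fun x => (k j : ℂ) * Complex.I *
      ((φ : (Fin 3 → ℝ) → ℂ) x * expFun (-k) x) :=
    continuous_const.mul (φ.2.1.continuous.mul (continuous_expFun _))
  rw [torusBox, MeasureTheory.integral_sub c1.continuousOn.integrableOn_Icc
    c2.continuousOn.integrableOn_Icc, MeasureTheory.integral_const_mul, sub_eq_zero] at h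
  exact h

theorem norm_testCoeff_le (φ : TestFunction) (k : Fin 3 → ℤ) (B : ℝ)
    (hB : ∀ x, ‖(φ : (Fin 3 → ℝ) → ℂ) x‖ ≤ B) : ‖testCoeff φ k‖ ≤ (2 * Real.pi) ^ 3 * B := by
  have hB0 : 0 ≤ B := (norm_nonneg _).trans (hB 0)
  have := MeasureTheory.norm_setIntegral_le_of_norm_le_const (μ := MeasureTheory.volume)
    (s := torusBox) (C := B) (f := fun x => (φ : (Fin 3 → ℝ) → ℂ) x * expFun (-k) x)
    (by unfold torusBox; exact isCompact_Icc.measure_lt_top) (fun x _ => by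
      rw [norm_mul, norm_expFun]
      exact (mul_le_of_le_one_right (norm_nonneg _) expFun_const_le_one).trans (hB x))
  rw [MeasureTheory.measureReal_def, volume_torusBox, mul_comm] at this
  exact this

theorem pow_mul_norm_testCoeff_le (p : ℕ) (φ : TestFunction) (j : Fin 3) (k : Fin 3 → ℤ) (B : ℝ)
    (hB : ∀ m ≤ p, ∀ x, ‖iteratedFDeriv ℝ m (φ : (Fin 3 → ℝ) → ℂ) x‖ ≤ B) :
    ‖k j‖ ^ p * ‖testCoeff φ k‖ ≤ (2 * Real.pi) ^ 3 * B := by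
  induction p generalizing φ with
  | zero =>
    rw [pow_zero, one_mul]
    exact norm_testCoeff_le φ k B fun x => by simpa using hB 0 le_rfl x
  | succ p ih =>
    have := ih ⟨_, mem_testFunction_deriv φ (Pi.single j 1)⟩ fun m hm x =>
      (norm_iteratedFDeriv_deriv_le φ j m x).trans (hB (m + 1) (by omega) x)
    simp only at this
    rw [testCoeff_deriv, norm_mul, norm_mul, Complex.norm_I, mul_one, Complex.norm_intCast,
      ← mul_assoc] at this
    rw [pow_succ, Int.norm_eq_abs]
    rwa [Int.norm_eq_abs] at this

theorem weight_pow_mul_norm_testCoeff_le (p : ℕ) (φ : TestFunction) (k : Fin 3 → ℤ) (B : ℝ)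
    (hB : ∀ m ≤ p, ∀ x, ‖iteratedFDeriv ℝ m (φ : (Fin 3 → ℝ) → ℂ) x‖ ≤ B) :
    (max 1 ‖k‖) ^ p * ‖testCoeff φ k‖ ≤ (2 * Real.pi) ^ 3 * B := by
  rcases le_total ‖k‖ 1 with h | h
  · rw [max_eq_left h, one_pow, one_mul]
    exact norm_testCoeff_le φ k B fun x => by simpa using hB 0 (Nat.zero_le _) x
  · rw [max_eq_right h]
    obtain ⟨j, hj⟩ : ∃ j, ‖k‖ = ‖k j‖ := by
      obtain ⟨j, -, hj⟩ := Finset.exists_mem_eq_sup' (s := Finset.univ) Finset.univ_nonempty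
        (fun i : Fin 3 => ‖k i‖)
      refine ⟨j, le_antisymm ?_ (norm_le_pi_norm k j)⟩
      rw [pi_norm_le_iff_of_nonneg (norm_nonneg _), ← hj]
      exact fun i => Finset.le_sup' (fun i : Fin 3 => ‖k i‖) (Finset.mem_univ i)
    rw [hj]
    exact pow_mul_norm_testCoeff_le p φ j k B hB

theorem summable_weight : Summable fun k : Fin 3 → ℤ => ((max 1 ‖k‖) ^ 4)⁻¹ := by
  let b := Pi.basisFun ℝ (Fin 3)
  let L := Submodule.span ℤ (Set.range b)
  have hf : Module.finrank ℤ L < 4 := by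
    rw [ZLattice.rank ℝ L]; simp
  have hs := ZLattice.summable_norm_pow_inv (L := L) 4 hf
  have hm : ∀ k : Fin 3 → ℤ, (fun i => (k i : ℝ)) ∈ L := fun k => by
    have : (fun i => (k i : ℝ)) = ∑ i, k i • b i := by
      funext j
      simp [b, Finset.sum_apply, Pi.single_apply]
    rw [this]
    exact Submodule.sum_mem _ fun i _ => Submodule.smul_mem _ _ (Submodule.subset_span ⟨i, rfl⟩)
  let f : (Fin 3 → ℤ) → L := fun k => ⟨fun i => (k i : ℝ), hm k⟩
  have hinj : Function.Injective f := fun k l h => by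
    funext i
    have h' : (k i : ℝ) = (l i : ℝ) := congrFun (congrArg Subtype.val h) i
    exact_mod_cast h'
  have h1 := hs.comp_injective hinj
  have h2 : Summable fun k : Fin 3 → ℤ => if k = 0 then (1 : ℝ) else 0 :=
    summable_of_ne_finset_zero (s := {0}) (by simp)
  refine Summable.of_nonneg_of_le (fun k => by positivity) (fun k => ?_) (h1.add h2)
  by_cases hk : k = 0
  · subst hk; simp
  · have hn : ‖f k‖ = ‖k‖ := by
      change ‖(fun i => (k i : ℝ))‖ = ‖k‖
      simp only [Pi.norm_def]
      congr 1
    have hk1 : 0 < ‖k‖ := norm_pos_iff.mpr hk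
    simp only [Function.comp_apply, hn, hk, if_false, add_zero]
    rw [inv_pow]
    exact inv_anti₀ (by positivity) (pow_le_pow_left₀ hk1.le (le_max_right _ _) 4)

theorem integral_expFun_eq_zero (k : Fin 3 → ℤ) (hk : k ≠ 0) : ∫ x in torusBox, expFun k x = 0 := by
  obtain ⟨j, hj⟩ := Function.ne_iff.mp hk
  have h := integral_fderiv_eq_zero (expFun k) ((contDiff_expFun k).of_le (by exact_mod_cast le_top))
    (expFun_periodic k) j
  have hp : phase k (Pi.single j 1) = (k j : ℂ) * Complex.I := by
    rw [phase_apply, Finset.sum_eq_single j] <;> simp +contextual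
  have e : ∀ x, fderiv ℝ (expFun k) x (Pi.single j 1) = (k j : ℂ) * Complex.I * expFun k x := by
    intro x
    rw [(hasFDerivAt_expFun k x).fderiv, _root_.smul_apply, hp, smul_eq_mul, mul_comm]
  simp only [e] at h
  rw [MeasureTheory.integral_const_mul] at h
  refine (mul_eq_zero.mp h).resolve_left (mul_ne_zero ?_ Complex.I_ne_zero)
  exact_mod_cast hj

theorem expFun_mul_expFun (k l : Fin 3 → ℤ) (x : Fin 3 → ℝ) :
    expFun k x * expFun l x = (((2 * Real.pi) ^ (-(3 / 2) : ℝ) : ℝ) : ℂ) * expFun (k + l) x := by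
  unfold expFun
  have : ∑ i, ((k + l) i : ℂ) * Complex.I * (x i : ℂ) =
      (∑ i, (k i : ℂ) * Complex.I * (x i : ℂ)) + ∑ i, (l i : ℂ) * Complex.I * (x i : ℂ) := by
    rw [← Finset.sum_add_distrib]
    refine Finset.sum_congr rfl fun i _ => ?_
    simp only [Pi.add_apply]; push_cast; ring
  rw [this, Complex.exp_add]; ring

/-- Orthonormality of the functions `e_k`. -/
theorem testCoeff_expFun (k l : Fin 3 → ℤ) : testCoeff (expFun k) l = if k = l then 1 else 0 := by
  unfold testCoeff
  simp only [expFun_mul_expFun]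
  rw [MeasureTheory.integral_const_mul]
  split_ifs with h
  · subst h
    have e : ∀ x, expFun (k + -k) x = (((2 * Real.pi) ^ (-(3 / 2) : ℝ) : ℝ) : ℂ) := fun x => by
      unfold expFun; simp
    simp only [e]
    rw [MeasureTheory.setIntegral_const, MeasureTheory.measureReal_def, volume_torusBox,
      Complex.real_smul, ← Complex.ofReal_mul, ← Complex.ofReal_mul, ← Complex.ofReal_one]
    congr 1
    have h0 : (0 : ℝ) < 2 * Real.pi := by positivity
    rw [← Real.rpow_natCast, ← Real.rpow_add h0, ← Real.rpow_add h0]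
    norm_num
  · rw [integral_expFun_eq_zero _ (fun h' => h (by simpa [add_neg_eq_zero] using h')), mul_zero]

/-- The Fourier coefficients of a distribution grow at most polynomially. -/
theorem exists_norm_fourierCoeff_le (u : Distribution) :
    ∃ (N : ℕ) (C : ℝ), ∀ k, ‖fourierCoeff u k‖ ≤ C * (max 1 ‖k‖) ^ N := by
  obtain ⟨N, C, h⟩ := u.2
  refine ⟨N, C * 3 ^ N, fun k => ?_⟩
  have := h (expTest (-k)) ((3 * max 1 ‖k‖) ^ N) fun m hm x => by
    refine (norm_iteratedFDeriv_expFun_le (-k) m x).trans ?_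
    rw [norm_neg]
    exact pow_le_pow_right₀ (by nlinarith [le_max_left 1 ‖k‖]) hm
  rwa [mul_pow, ← mul_assoc] at this

/-- The absolutely convergent series `∑_k m(k) û(k) φ̂(-k)`. -/
theorem exists_multiplier_bound (m : (Fin 3 → ℤ) → ℂ) (hm : ∃ M, ∀ k, ‖m k‖ ≤ M)
    (u : Distribution) : ∃ (p : ℕ) (C : ℝ), ∀ (φ : TestFunction) (B : ℝ),
      (∀ q ≤ p, ∀ x, ‖iteratedFDeriv ℝ q (φ : (Fin 3 → ℝ) → ℂ) x‖ ≤ B) →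
      ∀ k, ‖m k * fourierCoeff u k * testCoeff φ (-k)‖ ≤ C * B * ((max 1 ‖k‖) ^ 4)⁻¹ := by
  obtain ⟨M, hM⟩ := hm
  obtain ⟨N, C, hC⟩ := exists_norm_fourierCoeff_le u
  have hM0 : 0 ≤ M := (norm_nonneg _).trans (hM 0)
  refine ⟨N + 4, M * C * (2 * Real.pi) ^ 3, fun φ B hB k => ?_⟩
  have h := weight_pow_mul_norm_testCoeff_le (N + 4) φ (-k) B hB
  rw [norm_neg] at h
  set w := max 1 ‖k‖
  have hw : 0 < w := lt_of_lt_of_le one_pos (le_max_left _ _)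
  have hC0 : 0 ≤ C * w ^ N := (norm_nonneg _).trans (hC k)
  rw [← div_eq_mul_inv, le_div_iff₀ (by positivity), norm_mul, norm_mul]
  have hC1 : 0 ≤ C := nonneg_of_mul_nonneg_left hC0 (by positivity)
  calc ‖m k‖ * ‖fourierCoeff u k‖ * ‖testCoeff φ (-k)‖ * w ^ 4
      ≤ M * (C * w ^ N) * ‖testCoeff φ (-k)‖ * w ^ 4 := by
        gcongr
        · exact hM k
        · exact hC k
    _ = M * C * (w ^ (N + 4) * ‖testCoeff φ (-k)‖) := by ring
    _ ≤ M * C * ((2 * Real.pi) ^ 3 * B) := by gcongr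
    _ = _ := by ring

theorem exists_deriv_bound (p : ℕ) (φ : TestFunction) :
    ∃ B, ∀ q ≤ p, ∀ x, ‖iteratedFDeriv ℝ q (φ : (Fin 3 → ℝ) → ℂ) x‖ ≤ B := by
  have h1 : ∀ q : ℕ, ∃ B, ∀ x, ‖iteratedFDeriv ℝ q (φ : (Fin 3 → ℝ) → ℂ) x‖ ≤ B := by
    intro q
    have hc : Continuous (iteratedFDeriv ℝ q (φ : (Fin 3 → ℝ) → ℂ)) :=
      φ.2.1.continuous_iteratedFDeriv (by exact_mod_cast le_top)
    obtain ⟨B, hB⟩ := (isCompact_Icc (a := fun _ : Fin 3 => (0 : ℝ))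
      (b := fun _ => 2 * Real.pi)).exists_bound_of_continuousOn hc.continuousOn
    refine ⟨B, fun x => ?_⟩
    let k : Fin 3 → ℤ := fun i => -toIcoDiv Real.two_pi_pos 0 (x i)
    have hk : (fun y : Fin 3 → ℝ => (φ : (Fin 3 → ℝ) → ℂ) (y + fun i => 2 * Real.pi * k i))
        = (φ : (Fin 3 → ℝ) → ℂ) := by
      funext y; exact φ.2.2 y k
    have h2 := iteratedFDeriv_comp_add_right (𝕜 := ℝ) (f := (φ : (Fin 3 → ℝ) → ℂ)) q
      (fun i => 2 * Real.pi * k i) x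
    rw [hk] at h2
    rw [h2]
    have hmem : ∀ i, x i + 2 * Real.pi * k i ∈ Set.Ico (0 : ℝ) (0 + 2 * Real.pi) := fun i => by
      have := sub_toIcoDiv_zsmul_mem_Ico Real.two_pi_pos 0 (x i)
      have e : x i + 2 * Real.pi * k i = x i - toIcoDiv Real.two_pi_pos 0 (x i) • (2 * Real.pi) := by
        rw [zsmul_eq_mul]; simp only [k]; push_cast; ring
      rw [e]; exact this
    exact hB _ ⟨fun i => (hmem i).1, fun i => by simpa using (hmem i).2.le⟩
  choose B hB using h1
  refine ⟨∑ q ∈ Finset.range (p + 1), |B q|, fun q hq x => ?_⟩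
  refine (hB q x).trans ((le_abs_self _).trans ?_)
  exact Finset.single_le_sum (f := fun q => |B q|) (fun _ _ => abs_nonneg _)
    (Finset.mem_range.mpr (by omega))

theorem summable_multiplier (m : (Fin 3 → ℤ) → ℂ) (hm : ∃ M, ∀ k, ‖m k‖ ≤ M)
    (u : Distribution) (φ : TestFunction) :
    Summable fun k => m k * fourierCoeff u k * testCoeff φ (-k) := by
  obtain ⟨p, C, h⟩ := exists_multiplier_bound m hm u
  obtain ⟨B, hB⟩ := exists_deriv_bound p φ
  exact Summable.of_norm_bounded (summable_weight.mul_left (C * B)) (h φ B hB)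

theorem testCoeff_add (φ ψ : TestFunction) (k : Fin 3 → ℤ) :
    testCoeff (φ + ψ : TestFunction) k = testCoeff φ k + testCoeff ψ k := by
  have c : ∀ φ : TestFunction, MeasureTheory.IntegrableOn
      (fun x => (φ : (Fin 3 → ℝ) → ℂ) x * expFun (-k) x) torusBox := fun φ =>
    (φ.2.1.continuous.mul (continuous_expFun _)).continuousOn.integrableOn_Icc
  unfold testCoeff
  rw [← MeasureTheory.integral_add (c φ) (c ψ)]
  congr 1
  funext x
  simp [add_mul]

theorem testCoeff_smul (c : ℂ) (φ : TestFunction) (k : Fin 3 → ℤ) :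
    testCoeff (c • φ : TestFunction) k = c * testCoeff φ k := by
  unfold testCoeff
  rw [← MeasureTheory.integral_const_mul]
  congr 1
  funext x
  simp [mul_assoc]

/-- The Fourier multiplier `m(D)` with bounded symbol `m`: the distribution `m(D)u` with Fourier
coefficients `m(k) û(k)` (see `fourierCoeff_multiplier`). -/
def multiplier (m : (Fin 3 → ℤ) → ℂ) (hm : ∃ M, ∀ k, ‖m k‖ ≤ M) (u : Distribution) :
    Distribution where
  val :=
    { toFun := fun φ => ∑' k, m k * fourierCoeff u k * testCoeff φ (-k)
      map_add' := fun φ ψ => by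
        rw [← (summable_multiplier m hm u φ).tsum_add (summable_multiplier m hm u ψ)]
        exact tsum_congr fun k => by rw [testCoeff_add, mul_add]
      map_smul' := fun c φ => by
        rw [RingHom.id_apply, smul_eq_mul, ← tsum_mul_left]
        exact tsum_congr fun k => by rw [testCoeff_smul]; ring }
  property := by
    obtain ⟨p, C, h⟩ := exists_multiplier_bound m hm u
    refine ⟨p, C * ∑' k : Fin 3 → ℤ, ((max 1 ‖k‖) ^ 4)⁻¹, fun φ B hB => ?_⟩
    have := tsum_of_norm_bounded (summable_weight.mul_left (C * B)).hasSum (h φ B hB)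
    rw [tsum_mul_left] at this
    refine this.trans (le_of_eq ?_)
    ring

theorem fourierCoeff_multiplier (m : (Fin 3 → ℤ) → ℂ) (hm : ∃ M, ∀ k, ‖m k‖ ≤ M)
    (u : Distribution) (k : Fin 3 → ℤ) :
    fourierCoeff (multiplier m hm u) k = m k * fourierCoeff u k := by
  change ∑' l, m l * fourierCoeff u l * testCoeff (expFun (-k)) (-l) = _
  rw [tsum_eq_single k]
  · rw [testCoeff_expFun, if_pos rfl, mul_one]
  · intro l hl
    rw [testCoeff_expFun, if_neg (fun h => hl (neg_injective h).symm), mul_zero]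

/-! ### Littlewood-Paley blocks and Hölder-Besov norms -/

/-- The frequency space `ℝ³` with its Euclidean norm. -/
abbrev Freq := EuclideanSpace ℝ (Fin 3)

/-- A lattice point of `ℤ³` as an element of `ℝ³`. -/
def latticePoint (k : Fin 3 → ℤ) : Freq := WithLp.toLp 2 fun i => (k i : ℝ)

/-- Dyadic partitions of unity `(χ, θ)`. -/
structure IsDyadicPartition (χ θ : Freq → ℝ) : Prop where
  contDiff_chi : ContDiff ℝ ∞ χ
  contDiff_theta : ContDiff ℝ ∞ θ
  chi_nonneg : ∀ z, 0 ≤ χ z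
  theta_nonneg : ∀ z, 0 ≤ θ z
  chi_radial : ∀ y z, ‖y‖ = ‖z‖ → χ y = χ z
  theta_radial : ∀ y z, ‖y‖ = ‖z‖ → θ y = θ z
  chi_support : ∃ R : ℝ, tsupport χ ⊆ {z | ‖z‖ ≤ R}
  theta_support : ∃ r R : ℝ, 0 < r ∧ tsupport θ ⊆ {z | r ≤ ‖z‖ ∧ ‖z‖ ≤ R}
  sum_eq_one : ∀ z, χ z + ∑' j : ℕ, θ (((2 : ℝ) ^ j)⁻¹ • z) = 1
  chi_disjoint : ∀ j : ℕ, 1 ≤ j → Disjoint (tsupport χ) (tsupport fun z => θ (((2 : ℝ) ^ j)⁻¹ • z))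
  theta_disjoint : ∀ i j : ℕ, i + 1 < j →
    Disjoint (tsupport fun z => θ (((2 : ℝ) ^ i)⁻¹ • z)) (tsupport fun z => θ (((2 : ℝ) ^ j)⁻¹ • z))

/-- The cutoffs of the Littlewood-Paley blocks. The index is shifted by one: `0` stands for the
block `Δ_{-1}` with cutoff `χ`, and `j + 1` for the block `Δ_j` with cutoff `θ(2^{-j} ·)`. -/
def lpCutoff (χ θ : Freq → ℝ) : ℕ → Freq → ℝ
  | 0, z => χ z
  | j + 1, z => θ (((2 : ℝ) ^ j)⁻¹ • z)

/-- The Littlewood-Paley block `Δ_{n-1} u` as a function: the trigonometric polynomial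
`∑_k ρ(k) û(k) e_k`, with `ρ` the (compactly supported) cutoff of the block. -/
def lpBlock (χ θ : Freq → ℝ) (n : ℕ) (u : Distribution) (x : Fin 3 → ℝ) : ℂ :=
  ∑' k, (lpCutoff χ θ n (latticePoint k) : ℂ) * fourierCoeff u k * expFun k x

/-- The norm `‖u‖_α = ∑_i sup_{j ≥ -1} 2^{jα} ‖Δ_j u^i‖_{L^∞}` of the Hölder-Besov space
`C^α = B^α_{∞,∞}` of vectors of `d` distributions, as a number in `[0, ∞]`; here `j = n - 1`. -/
def besovNorm (χ θ : Freq → ℝ) (α : ℝ) {d : ℕ} (u : Fin d → Distribution) : ℝ≥0∞ :=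
  ∑ i, ⨆ n : ℕ, ENNReal.ofReal ((2 : ℝ) ^ (((n : ℝ) - 1) * α)) * ⨆ x, ‖lpBlock χ θ n (u i) x‖ₑ

/-! ### The heat semigroup and its approximation -/

/-- The function `s ↦ e^{-s}` on `[0, ∞]`, with `e^{-∞} = 0`. -/
def expNeg (s : ℝ≥0∞) : ℝ := if s = ⊤ then 0 else Real.exp (-s.toReal)

theorem norm_expNeg_le (s : ℝ≥0∞) : ‖((expNeg s : ℝ) : ℂ)‖ ≤ 1 := by
  unfold expNeg
  split_ifs
  · simp
  · rw [Complex.norm_real, Real.norm_of_nonneg (Real.exp_pos _).le]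
    exact Real.exp_le_one_iff.mpr (neg_nonpos.mpr ENNReal.toReal_nonneg)

/-- The assumptions on `f̃`. The regularity, the derivative bounds and the lower bound are asked on
the cube `{|x^i| < 3 L₀}`; at the origin, where the derivatives may blow up, only continuity is. -/
structure IsAdmissible (L₀ : ℝ) (ftilde : Freq → ℝ) : Prop where
  nonneg : ∀ x, 0 ≤ ftilde x
  even : ∀ x, ftilde (-x) = ftilde x
  map_zero : ftilde 0 = 1
  continuousAt_zero : ContinuousAt ftilde 0
  contDiffOn : ContDiffOn ℝ 5 ftilde {x | x ≠ 0 ∧ ∀ i, |x i| < 3 * L₀}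
  deriv_bound : ∃ C : ℝ, ∀ m : ℕ, m ≤ 5 → ∀ x : Freq, x ≠ 0 → (∀ i, |x i| < 3 * L₀) →
    ‖iteratedFDeriv ℝ m ftilde x‖ ≤ C * (‖x‖ ^ (1 - (m : ℤ)) + 1)
  lower_bound : ∃ c : ℝ, 0 < c ∧ ∀ x : Freq, (∀ i, |x i| < 3 * L₀) → c ≤ ftilde x

open Classical in
/-- The function `f`, equal to `f̃` on the cube `{|x^i| ≤ L₀}` and to `∞` elsewhere. -/
def fCut (L₀ : ℝ) (ftilde : Freq → ℝ) (x : Freq) : ℝ≥0∞ :=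
  if ∀ i, |x i| ≤ L₀ then ENNReal.ofReal (ftilde x) else ⊤

/-- The heat semigroup `P_t = e^{tΔ}`, the Fourier multiplier with symbol `e^{-t|k|²}`. -/
def heat (t : ℝ) : Distribution → Distribution :=
  multiplier (fun k => (expNeg (ENNReal.ofReal (t * ‖latticePoint k‖ ^ 2)) : ℝ))
    ⟨1, fun _ => norm_expNeg_le _⟩

/-- The approximated heat semigroup `P_t^ε = e^{tΔ_ε}`, the Fourier multiplier with symbol
`e^{-t|k|² f(εk)}`. -/
def approxHeat (L₀ : ℝ) (ftilde : Freq → ℝ) (ε t : ℝ) : Distribution → Distribution :=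
  multiplier (fun k => (expNeg (ENNReal.ofReal (t * ‖latticePoint k‖ ^ 2) *
    fCut L₀ ftilde (ε • latticePoint k)) : ℝ)) ⟨1, fun _ => norm_expNeg_le _⟩

/-- The symbol of the heat semigroup. -/
theorem fourierCoeff_heat {t : ℝ} (ht : 0 ≤ t) (u : Distribution) (k : Fin 3 → ℤ) :
    fourierCoeff (heat t u) k =
      (Real.exp (-(t * ‖latticePoint k‖ ^ 2)) : ℝ) * fourierCoeff u k := by
  rw [heat, fourierCoeff_multiplier, expNeg, if_neg ENNReal.ofReal_ne_top,
    ENNReal.toReal_ofReal (by positivity)]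

open Classical in
/-- The symbol of the approximated heat semigroup. -/
theorem fourierCoeff_approxHeat {L₀ : ℝ} (hL : 0 < L₀) {ftilde : Freq → ℝ}
    (hf : ∀ x, 0 ≤ ftilde x) (ε : ℝ) {t : ℝ} (ht : 0 < t) (u : Distribution) (k : Fin 3 → ℤ) :
    fourierCoeff (approxHeat L₀ ftilde ε t u) k =
      ((if ∀ i, |ε * k i| ≤ L₀ then
        Real.exp (-(t * ‖latticePoint k‖ ^ 2 * ftilde (ε • latticePoint k))) else 0 : ℝ) : ℂ) *
        fourierCoeff u k := by
  rw [approxHeat, fourierCoeff_multiplier]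
  congr 2
  have e : (∀ i, |(ε • latticePoint k) i| ≤ L₀) ↔ ∀ i, |ε * k i| ≤ L₀ := by
    simp [latticePoint]
  unfold fCut
  simp only [e]
  split_ifs with h
  · rw [← ENNReal.ofReal_mul (by positivity), expNeg, if_neg ENNReal.ofReal_ne_top,
      ENNReal.toReal_ofReal (mul_nonneg (by positivity) (hf _))]
  · have hk : latticePoint k ≠ 0 := fun h0 => h (e.mp (by rw [h0]; simp [hL.le]))
    have hp : 0 < t * ‖latticePoint k‖ ^ 2 := by
      have := norm_pos_iff.mpr hk
      positivity
    rw [ENNReal.mul_top (by simpa using hp), expNeg, if_pos rfl]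

end
end TorusBesov

namespace TorusBesov

open scoped ENNReal ContDiff Topology

noncomputable section

/-! ### Fourier multipliers on trigonometric polynomials -/

/-! Everything reduces to one Littlewood-Paley block at frequency scale `X = 2^j`. There the symbol
of `P_t^ε - P_t` must act on trigonometric polynomials, in the supremum norm, with norm at most a
constant times `ε^η t^(-δ/2) X^(η-δ+κ)`. The neighbouring cutoffs sum to one on the block, so the
output block is this multiplier applied to at most three blocks of `u`; the weights `2^(jα)` then
give the claim.

After rescaling by `X` the symbols live on a fixed annulus, with parameters `e = εX` and `T = tX²`.
Inside the cube, the exponents `T|z|²` and `T|z|² f̃(ez)` are joined linearly with a parameter `s`.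
The `s`-derivative of the symbol contains `T|z|²(f̃(ez) - 1)`, which is of size `Te` together with
three derivatives, because `f̃` is Lipschitz at the origin and its derivatives blow up no faster
than scaling allows. The exponential absorbs powers of `T` and yields `T^(-δ/2)`, while `e ≤ E^(1-η)
e^η` since `e` is bounded on the relevant set (`exists_derivBound_interpolation`).

The cube cutoff is sharp, so smooth-multiplier bounds do not apply to it. Instead, symbols are
sampled on a box of frequencies and summed by parts in each of the three coordinates
(`MulBound.of_derivBound`). This costs one derivative per coordinate and three norms of interval
projections. Dirichlet kernels bound each such norm by `n^κ'` (`exists_mulBound_interval`), and the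
total loss `X^(3κ')` is absorbed by `κ`.

If the cutoff reaches the block, then `εX` is bounded below; no smallness in `ε` is needed, and the
two heat terms left over are estimated separately (`exists_mulBound_symbolDiff`). -/

/-- The symbol `m` defines a Fourier multiplier of norm at most `Λ` for the supremum norm on
trigonometric polynomials. -/
def MulBound (m : (Fin 3 → ℤ) → ℝ) (Λ : ℝ) : Prop :=
  ∀ (s : Finset (Fin 3 → ℤ)) (c : (Fin 3 → ℤ) → ℂ) (B : ℝ),
    (∀ x, ‖∑ k ∈ s, c k * expFun k x‖ ≤ B) → ∀ x, ‖∑ k ∈ s, (m k : ℂ) * c k * expFun k x‖ ≤ Λ * B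

namespace MulBound

variable {m m₁ m₂ : (Fin 3 → ℤ) → ℝ} {Λ Λ₁ Λ₂ : ℝ}

theorem mono (h : MulBound m Λ₁) (hΛ : Λ₁ ≤ Λ₂) : MulBound m Λ₂ := fun s c B hB x =>
  (h s c B hB x).trans (mul_le_mul_of_nonneg_right hΛ ((norm_nonneg _).trans (hB 0)))

theorem congr (h : MulBound m₁ Λ) (e : ∀ k, m₂ k = m₁ k) : MulBound m₂ Λ := by
  rwa [show m₂ = m₁ from funext e]

theorem const (a : ℝ) : MulBound (fun _ => a) |a| := fun s c B hB x => by
  simp only [mul_assoc]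
  rw [← Finset.mul_sum, norm_mul, Complex.norm_real, Real.norm_eq_abs]
  exact mul_le_mul_of_nonneg_left (hB x) (abs_nonneg _)

theorem zero : MulBound (fun _ => 0) 0 := by simpa using const 0

theorem add (h₁ : MulBound m₁ Λ₁) (h₂ : MulBound m₂ Λ₂) :
    MulBound (fun k => m₁ k + m₂ k) (Λ₁ + Λ₂) := fun s c B hB x => by
  have e : ∑ k ∈ s, ((m₁ k + m₂ k : ℝ) : ℂ) * c k * expFun k x =
      ∑ k ∈ s, (m₁ k : ℂ) * c k * expFun k x + ∑ k ∈ s, (m₂ k : ℂ) * c k * expFun k x := by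
    rw [← Finset.sum_add_distrib]
    exact Finset.sum_congr rfl fun k _ => by push_cast; ring
  rw [e, add_mul]
  exact (norm_add_le _ _).trans (add_le_add (h₁ s c B hB x) (h₂ s c B hB x))

theorem mul (h₁ : MulBound m₁ Λ₁) (h₂ : MulBound m₂ Λ₂) :
    MulBound (fun k => m₁ k * m₂ k) (Λ₁ * Λ₂) := fun s c B hB x => by
  have := h₁ s (fun k => (m₂ k : ℂ) * c k) (Λ₂ * B) (h₂ s c B hB) x
  rw [mul_assoc]
  simpa only [Complex.ofReal_mul, mul_assoc] using this

theorem neg (h : MulBound m Λ) : MulBound (fun k => -m k) Λ := by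
  simpa using (const (-1)).mul h

theorem sub (h₁ : MulBound m₁ Λ₁) (h₂ : MulBound m₂ Λ₂) :
    MulBound (fun k => m₁ k - m₂ k) (Λ₁ + Λ₂) := by
  simpa [sub_eq_add_neg] using h₁.add h₂.neg

theorem sum {N : ℕ} {m : ℕ → (Fin 3 → ℤ) → ℝ} (h : ∀ l < N, MulBound (m l) Λ) :
    MulBound (fun k => ∑ l ∈ Finset.range N, m l k) (N * Λ) := by
  induction N with
  | zero => simpa using zero
  | succ N ih =>
    simp only [Finset.sum_range_succ]
    refine ((ih fun l hl => h l (by omega)).add (h N (by omega))).mono (le_of_eq ?_)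
    push_cast; ring

/-- A symbol that depends differentiably on a parameter. -/
theorem sub_of_hasDerivAt {m m' : ℝ → (Fin 3 → ℤ) → ℝ}
    (hd : ∀ s k, HasDerivAt (fun s => m s k) (m' s k) s)
    (h : ∀ s, 0 ≤ s → s ≤ 1 → MulBound (m' s) Λ) : MulBound (fun k => m 1 k - m 0 k) Λ := by
  intro S c B hB x
  -- Mean value inequality in `s`, at a fixed point `x` and for a fixed finite sum; the bound on the
  -- derivative is uniform in both.
  have key := norm_image_sub_le_of_norm_deriv_le_segment_01'
    (f := fun s => ∑ k ∈ S, (m s k : ℂ) * c k * expFun k x)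
    (f' := fun s => ∑ k ∈ S, (m' s k : ℂ) * c k * expFun k x) (C := Λ * B)
    (fun s _ => (HasDerivAt.fun_sum fun k _ =>
      (((hd s k).ofReal_comp).mul_const (c k)).mul_const (expFun k x)).hasDerivWithinAt)
    (fun s hs => h s hs.1 hs.2.le S c B hB x)
  rw [← Finset.sum_sub_distrib] at key
  refine le_of_eq_of_le (congrArg norm (Finset.sum_congr rfl fun k _ => ?_)) key
  push_cast; ring

end MulBound

/-! ### Frequency intervals -/

/-- Translation in one variable modulates the coefficients by a character of `k i`, so convolution
in that variable with a one-dimensional kernel is a multiplier in `k i`. -/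
theorem expFun_sub_single (k : Fin 3 → ℤ) (x : Fin 3 → ℝ) (i : Fin 3) (y : ℝ) :
    expFun k (x - Pi.single i y) = expFun k x * Complex.exp (-((k i : ℂ) * Complex.I * y)) := by
  unfold expFun
  rw [mul_assoc, ← Complex.exp_add]
  congr 2
  have : ∀ l, (k l : ℂ) * Complex.I * ((x - Pi.single i y : Fin 3 → ℝ) l : ℂ) =
      (k l : ℂ) * Complex.I * (x l : ℂ) - if l = i then (k i : ℂ) * Complex.I * y else 0 := by
    intro l
    by_cases h : l = i
    · subst h; simp; ring
    · simp [h]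
  simp only [this, Finset.sum_sub_distrib, Finset.sum_ite_eq', Finset.mem_univ, if_true]
  ring

/-- The Dirichlet kernel of the frequencies `a, …, a + n - 1`. -/
def dirichletKernel (a : ℤ) (n : ℕ) (y : ℝ) : ℂ :=
  ∑ p ∈ Finset.range n, Complex.exp (((a + p : ℤ) : ℂ) * Complex.I * y)

theorem integral_exp_int (q : ℤ) :
    ∫ y in (-Real.pi)..Real.pi, Complex.exp ((q : ℂ) * Complex.I * y) =
      if q = 0 then (2 * Real.pi : ℂ) else 0 := by
  split_ifs with h
  · subst h; simp; ring
  · have hq : (q : ℂ) * Complex.I ≠ 0 := mul_ne_zero (by exact_mod_cast h) Complex.I_ne_zero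
    rw [integral_exp_mul_complex hq, div_eq_zero_iff]
    left
    rw [sub_eq_zero, Complex.exp_eq_exp_iff_exists_int]
    exact ⟨q, by push_cast; ring⟩

theorem norm_dirichletKernel_le (a : ℤ) (n : ℕ) (y : ℝ) : ‖dirichletKernel a n y‖ ≤ n := by
  refine (norm_sum_le _ _).trans ?_
  have : ∀ p ∈ Finset.range n, ‖Complex.exp (((a + p : ℤ) : ℂ) * Complex.I * y)‖ ≤ 1 := by
    intro p _
    rw [show ((a + p : ℤ) : ℂ) * Complex.I * y = (((a + p : ℤ) * y : ℝ) : ℂ) * Complex.I by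
      push_cast; ring, Complex.norm_exp_ofReal_mul_I]
  simpa using Finset.sum_le_sum this

/-- The kernel is a geometric sum: its numerator is at most 2 and its denominator `2|sin(y/2)|` is
at least `2|y|/π`. -/
theorem norm_dirichletKernel_le_div (a : ℤ) (n : ℕ) {y : ℝ} (hy : y ≠ 0) (hy' : |y| ≤ Real.pi) :
    ‖dirichletKernel a n y‖ ≤ Real.pi / |y| := by
  have e : dirichletKernel a n y = Complex.exp (((a * y : ℝ) : ℂ) * Complex.I) *
      ∑ p ∈ Finset.range n, Complex.exp (Complex.I * y) ^ p := by
    unfold dirichletKernel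
    rw [Finset.mul_sum]
    refine Finset.sum_congr rfl fun p _ => ?_
    rw [← Complex.exp_nat_mul, ← Complex.exp_add]
    congr 1; push_cast; ring
  have hs : 2 / Real.pi * |y| ≤ ‖Complex.exp (Complex.I * y) - 1‖ := by
    rw [Complex.norm_exp_I_mul_ofReal_sub_one, norm_mul, Real.norm_eq_abs, Real.norm_eq_abs]
    have h2 : |y / 2| = |y| / 2 := by rw [abs_div]; norm_num
    have := Real.mul_abs_le_abs_sin (x := y / 2) (by rw [h2]; linarith)
    rw [h2] at this
    rw [abs_two]
    linarith
  have hpos : 0 < 2 / Real.pi * |y| := by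
    have := abs_pos.mpr hy
    have := Real.pi_pos
    positivity
  have hne : Complex.exp (Complex.I * y) ≠ 1 := fun h => by
    rw [h, sub_self, norm_zero] at hs; linarith
  rw [e, norm_mul, Complex.norm_exp_ofReal_mul_I, one_mul, geom_sum_eq hne, norm_div,
    div_le_div_iff₀ (hpos.trans_le hs) (abs_pos.mpr hy)]
  have h1 : ‖Complex.exp (Complex.I * y) ^ n - 1‖ ≤ 2 := by
    refine (norm_sub_le _ _).trans ?_
    rw [norm_pow, mul_comm, Complex.norm_exp_ofReal_mul_I]
    norm_num
  calc _ ≤ 2 * |y| := by gcongr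
    _ = Real.pi * (2 / Real.pi * |y|) := by field_simp
    _ ≤ _ := by gcongr

theorem intervalIntegrable_abs_rpow {r : ℝ} (hr : -1 < r) :
    IntervalIntegrable (fun y : ℝ => |y| ^ r) MeasureTheory.volume (-Real.pi) Real.pi := by
  have h : IntervalIntegrable (fun y : ℝ => |y| ^ r) MeasureTheory.volume 0 Real.pi := by
    refine (intervalIntegral.intervalIntegrable_rpow' hr).congr ?_
    intro y hy
    rw [Set.uIoc_of_le Real.pi_pos.le] at hy
    simp only [abs_of_pos hy.1]
  refine IntervalIntegrable.trans (b := 0) ?_ h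
  have := h.comp_sub_left 0
  simp only [zero_sub, abs_neg, sub_zero] at this
  exact this.symm

/-- The projection on an interval of `n` frequencies in one coordinate loses at most an arbitrarily
small power of `n`. -/
theorem exists_mulBound_interval {κ : ℝ} (hκ : 0 < κ) (hκ' : κ < 1) :
    ∃ C : ℝ, 0 < C ∧ ∀ (i : Fin 3) (a : ℤ) (n : ℕ),
      MulBound (fun k => if a ≤ k i ∧ k i < a + n then 1 else 0) (C * (n : ℝ) ^ κ) := by
  set J := ∫ y in (-Real.pi)..Real.pi, |y| ^ (κ - 1) with hJ
  have hπ := Real.pi_pos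
  have hJ0 : 0 ≤ J := intervalIntegral.integral_nonneg (by linarith) fun y _ => by positivity
  refine ⟨Real.pi ^ (1 - κ) * J / (2 * Real.pi) + 1, by positivity, fun i a n => ?_⟩
  refine MulBound.mono (Λ₁ := Real.pi ^ (1 - κ) * J / (2 * Real.pi) * (n : ℝ) ^ κ) ?_
    (mul_le_mul_of_nonneg_right (by linarith) (by positivity))
  intro s c B hB x
  have hB0 : 0 ≤ B := (norm_nonneg _).trans (hB 0)
  -- The integral of `g` is a convolution with the Dirichlet kernel in the `i`-th variable; by
  -- orthogonality it is `2π` times the projected polynomial.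
  set g : ℝ → ℂ := fun y => (∑ k ∈ s, c k * expFun k (x - Pi.single i y)) * dirichletKernel a n y
    with hg
  have e1 : ∀ y, g y = ∑ k ∈ s, ∑ p ∈ Finset.range n, c k * expFun k x *
      Complex.exp (((a + p - k i : ℤ) : ℂ) * Complex.I * y) := by
    intro y
    simp only [hg, dirichletKernel, expFun_sub_single]
    rw [Finset.sum_mul_sum]
    refine Finset.sum_congr rfl fun k _ => Finset.sum_congr rfl fun p _ => ?_
    rw [← mul_assoc, mul_assoc (c k * expFun k x), ← Complex.exp_add]
    congr 2; push_cast; ring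
  have e2 : ∫ y in (-Real.pi)..Real.pi, g y = 2 * Real.pi *
      ∑ k ∈ s, (((if a ≤ k i ∧ k i < a + n then 1 else 0 : ℝ)) : ℂ) * c k * expFun k x := by
    simp only [e1]
    rw [intervalIntegral.integral_finsetSum fun k _ =>
      (Continuous.intervalIntegrable (by fun_prop) _ _), Finset.mul_sum]
    refine Finset.sum_congr rfl fun k _ => ?_
    rw [intervalIntegral.integral_finsetSum fun p _ =>
      (Continuous.intervalIntegrable (by fun_prop) _ _)]
    simp only [intervalIntegral.integral_const_mul, integral_exp_int]
    split_ifs with h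
    · rw [Finset.sum_eq_single (k i - a).toNat]
      · rw [if_pos (by omega)]; push_cast; ring
      · intro p _ hp
        rw [if_neg (by omega), mul_zero]
      · intro hp
        exact absurd (Finset.mem_range.mpr (by omega)) hp
    · rw [Finset.sum_eq_zero]
      · simp
      · intro p hp
        have := Finset.mem_range.mp hp
        rw [if_neg (by omega), mul_zero]
  have hbd : ‖∫ y in (-Real.pi)..Real.pi, g y‖ ≤
      ∫ y in (-Real.pi)..Real.pi, (B * ((n : ℝ) ^ κ * Real.pi ^ (1 - κ))) * |y| ^ (κ - 1) := by
    refine intervalIntegral.norm_integral_le_of_norm_le (by linarith) ?_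
      ((intervalIntegrable_abs_rpow (by linarith)).const_mul _)
    have h0 : ∀ᵐ y : ℝ, y ≠ 0 := by
      simp [MeasureTheory.ae_iff]
    filter_upwards [h0] with y hy hy'
    have hy1 : |y| ≤ Real.pi := abs_le.mpr ⟨hy'.1.le, hy'.2⟩
    have hyp := abs_pos.mpr hy
    rw [hg, norm_mul, mul_assoc]
    refine mul_le_mul (hB _) ?_ (norm_nonneg _) hB0
    -- Geometric interpolation between the bounds `n` and `π/|y|`: the exponent `κ - 1` keeps the
    -- singularity integrable, at the price of `n^κ`.
    calc ‖dirichletKernel a n y‖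
        = ‖dirichletKernel a n y‖ ^ κ * ‖dirichletKernel a n y‖ ^ (1 - κ) := by
          rw [← Real.rpow_add_of_nonneg (norm_nonneg _) hκ.le (by linarith)]; simp
      _ ≤ (n : ℝ) ^ κ * (Real.pi / |y|) ^ (1 - κ) := by
          gcongr
          · exact norm_dirichletKernel_le a n y
          · exact norm_dirichletKernel_le_div a n hy hy1
      _ = _ := by
          rw [Real.div_rpow hπ.le hyp.le, mul_assoc, div_eq_mul_inv, ← Real.rpow_neg hyp.le]
          congr 3; ring
  rw [intervalIntegral.integral_const_mul, ← hJ, e2, norm_mul] at hbd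
  have h2π : ‖(2 * Real.pi : ℂ)‖ = 2 * Real.pi := by
    rw [norm_mul, Complex.norm_real, Real.norm_of_nonneg hπ.le]; simp
  rw [h2π, ← le_div_iff₀' (by positivity)] at hbd
  refine hbd.trans (le_of_eq ?_)
  ring

/-! ### Summation by parts on a frequency box -/

/-- Summation by parts in one coordinate: if the symbol `a l` and its increments in `l` are
controlled, so is the symbol in which `l` is set to the `i`-th coordinate of the frequency. -/
theorem MulBound.summation_by_parts {A : ℕ} {P Λ Λ' c : ℝ} {i : Fin 3}
    (hP : ∀ (a : ℤ) (n : ℕ), n ≤ 2 * A + 1 →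
      MulBound (fun k => if a ≤ k i ∧ k i < a + n then 1 else 0) P) (hP0 : 0 ≤ P)
    {a : ℤ → (Fin 3 → ℤ) → ℝ} (h₀ : ∀ l : ℤ, |l| ≤ A → MulBound (a l) Λ)
    (h₁ : ∀ l : ℤ, |l| ≤ A → |l + 1| ≤ A → MulBound (fun k => a (l + 1) k - a l k) Λ')
    (hc : 2 * A * Λ' ≤ c * Λ) :
    MulBound (fun k => if |k i| ≤ A then a (k i) k else 0) (P * (1 + c) * Λ) := by
  -- Abel summation from the left end `-A`: the increment from `-A + l` to `-A + l + 1` counts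
  -- exactly for the `2A - l` frequencies in `[-A + l + 1, A]`.
  have e : ∀ k : Fin 3 → ℤ, (if |k i| ≤ A then a (k i) k else 0) =
      (if -(A : ℤ) ≤ k i ∧ k i < -(A : ℤ) + (2 * A + 1 : ℕ) then 1 else 0) * a (-A) k +
        ∑ l ∈ Finset.range (2 * A),
          (if -(A : ℤ) + l + 1 ≤ k i ∧ k i < -(A : ℤ) + l + 1 + (2 * A - l : ℕ) then 1 else 0) *
            (a (-A + l + 1) k - a (-A + l) k) := by
    intro k
    by_cases hk : |k i| ≤ A
    · rw [abs_le] at hk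
      obtain ⟨n, hn⟩ : ∃ n : ℕ, k i = -A + n := ⟨(k i + A).toNat, by omega⟩
      have hs : ∀ l ∈ Finset.range (2 * A),
          (if -(A : ℤ) + l + 1 ≤ k i ∧ k i < -(A : ℤ) + l + 1 + (2 * A - l : ℕ) then (1 : ℝ)
            else 0) * (a (-A + l + 1) k - a (-A + l) k) =
          if l < n then a (-A + (l + 1 : ℕ)) k - a (-A + l) k else 0 := by
        intro l hl
        have hl := Finset.mem_range.mp hl
        by_cases h : l < n
        · rw [if_pos h, if_pos (by omega), one_mul]
          rw [Nat.cast_succ, add_assoc]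
        · rw [if_neg h, if_neg (by omega), zero_mul]
      rw [Finset.sum_congr rfl hs, ← Finset.sum_filter,
        show (Finset.range (2 * A)).filter (· < n) = Finset.range n by
          ext l; simp only [Finset.mem_filter, Finset.mem_range]; omega,
        Finset.sum_range_sub (fun l : ℕ => a (-A + l) k), if_pos (abs_le.mpr hk),
        if_pos (by omega), hn]
      simp
    · rw [if_neg hk]
      rw [abs_le, not_and_or] at hk
      rw [if_neg (by omega), Finset.sum_eq_zero]
      · simp
      · intro l hl
        have hl := Finset.mem_range.mp hl
        rw [if_neg (by omega), zero_mul]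
  refine MulBound.congr ?_ e
  refine (((hP _ _ le_rfl).mul (h₀ (-A) (by simp))).add
    (MulBound.sum (Λ := P * Λ') fun l hl => (hP _ _ (by omega)).mul
      (h₁ _ (by rw [abs_le]; omega) (by rw [abs_le]; omega)))).mono ?_
  push_cast
  nlinarith

/-- Bounds on the derivatives up to order `n` in a convex open set. -/
structure DerivBound (n : ℕ) (M : ℝ) (U : Set Freq) (g : Freq → ℝ) : Prop where
  isOpen : IsOpen U
  convex : Convex ℝ U
  contDiffAt : ∀ z ∈ U, ContDiffAt ℝ n g z
  bound : ∀ m ≤ n, ∀ z ∈ U, ‖iteratedFDeriv ℝ m g z‖ ≤ M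

theorem DerivBound.of_succ {n : ℕ} {M : ℝ} {U : Set Freq} {g : Freq → ℝ}
    (h : DerivBound (n + 1) M U g) : DerivBound n M U g where
  isOpen := h.isOpen
  convex := h.convex
  contDiffAt z hz := (h.contDiffAt z hz).of_le (by norm_cast; omega)
  bound m hm z hz := h.bound m (by omega) z hz

/-- The increments of a function with bounded derivatives. -/
theorem DerivBound.increment {n : ℕ} {M : ℝ} {U : Set Freq} {g : Freq → ℝ}
    (h : DerivBound (n + 1) M U g) (v : Freq) :
    DerivBound n (M * ‖v‖) (U ∩ (fun z => z + v) ⁻¹' U) (fun z => g (z + v) - g z) where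
  isOpen := h.isOpen.inter (h.isOpen.preimage (by fun_prop))
  convex := h.convex.inter (h.convex.translate_preimage_left v)
  contDiffAt z hz := by
    have h1 : ContDiffAt ℝ n g z := (h.contDiffAt z hz.1).of_le (by norm_cast; omega)
    have h2 : ContDiffAt ℝ n g (z + v) := (h.contDiffAt _ hz.2).of_le (by norm_cast; omega)
    exact (h2.comp z (f := fun z => z + v) (by fun_prop)).sub h1
  bound m hm z hz := by
    have h1 : ContDiffAt ℝ m g z := (h.contDiffAt z hz.1).of_le (by norm_cast; omega)
    have h2 : ContDiffAt ℝ m g (z + v) := (h.contDiffAt _ hz.2).of_le (by norm_cast; omega)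
    have h3 := iteratedFDeriv_comp_add_right (𝕜 := ℝ) (f := g) m v z
    change iteratedFDeriv ℝ m (g ∘ fun z => z + v) z = _ at h3
    change ‖iteratedFDeriv ℝ m ((g ∘ fun z => z + v) - g) z‖ ≤ _
    rw [iteratedFDeriv_sub_apply (h2.comp z (f := fun z => z + v) (by fun_prop)) h1, h3]
    have := h.convex.norm_image_sub_le_of_norm_fderiv_le (𝕜 := ℝ) (f := iteratedFDeriv ℝ m g)
      (C := M)
      (fun x hx => (h.contDiffAt x hx).differentiableAt_iteratedFDeriv (by norm_cast; omega))
      (fun x hx => by rw [norm_fderiv_iteratedFDeriv]; exact h.bound _ (by omega) x hx) hz.1 hz.2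
    simpa using this

/-- The function `g` along the grid of mesh `h` through `p`, with the coordinates in `L` running
through the box of size `A`. -/
def boxSymbol (A : ℕ) (h : ℝ) (g : Freq → ℝ) : List (Fin 3) → Freq → (Fin 3 → ℤ) → ℝ
  | [], p, _ => g p
  | i :: L, p, k =>
    if |k i| ≤ A then boxSymbol A h g L (p + (k i : ℝ) • EuclideanSpace.single i h) k else 0

/-- The grid of `boxSymbol` is contained in `U`. -/
def GridSubset (A : ℕ) (h : ℝ) (U : Set Freq) : List (Fin 3) → Freq → Prop
  | [], p => p ∈ U
  | i :: L, p => ∀ l : ℤ, |l| ≤ A → GridSubset A h U L (p + (l : ℝ) • EuclideanSpace.single i h)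

/-- Lets the induction over the coordinates treat the increment of a sampled symbol as the sampled
symbol of an increment. -/
theorem boxSymbol_increment (A : ℕ) (h : ℝ) (g : Freq → ℝ) (v : Freq) (L : List (Fin 3))
    (p : Freq) (k : Fin 3 → ℤ) :
    boxSymbol A h (fun z => g (z + v) - g z) L p k =
      boxSymbol A h g L (p + v) k - boxSymbol A h g L p k := by
  induction L generalizing p with
  | nil => rfl
  | cons i L ih =>
    simp only [boxSymbol]
    split_ifs
    · rw [ih, add_right_comm]
    · simp

theorem GridSubset.inter {A : ℕ} {h : ℝ} {U : Set Freq} {v : Freq} {L : List (Fin 3)} {p : Freq}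
    (h₁ : GridSubset A h U L p) (h₂ : GridSubset A h U L (p + v)) :
    GridSubset A h (U ∩ (fun z => z + v) ⁻¹' U) L p := by
  induction L generalizing p with
  | nil => exact ⟨h₁, h₂⟩
  | cons i L ih =>
    intro l hl
    refine ih (h₁ l hl) ?_
    have := h₂ l hl
    rwa [add_right_comm] at this

/-- Induction on the coordinates. Summing by parts in one coordinate leaves samples of `g` and of
its increment along that coordinate in the others. The increment has one derivative fewer and bound
`M * h`; the `2A` increments together thus cost at most `c` times the bound for `g`. -/
theorem MulBound.boxSymbol {A : ℕ} {P c h : ℝ} (hP0 : 0 ≤ P) (hc : 0 ≤ c) (hh : 0 ≤ h)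
    (hP : ∀ (i : Fin 3) (a : ℤ) (n : ℕ), n ≤ 2 * A + 1 →
      MulBound (fun k => if a ≤ k i ∧ k i < a + n then 1 else 0) P) (hA : 2 * A * h ≤ c)
    (L : List (Fin 3)) {M : ℝ} {U : Set Freq} {g : Freq → ℝ} (hg : DerivBound L.length M U g)
    {p : Freq} (hp : GridSubset A h U L p) :
    MulBound (boxSymbol A h g L p) ((P * (1 + c)) ^ L.length * M) := by
  induction L generalizing M U g p with
  | nil =>
    refine (MulBound.const (g p)).mono ?_
    have := hg.bound 0 le_rfl p hp
    rw [norm_iteratedFDeriv_zero, Real.norm_eq_abs] at this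
    simpa using this
  | cons i L ih =>
    have hpos : 0 ≤ P * (1 + c) := by positivity
    -- A grid point, the one with central coordinates, is needed only to know that `M` is
    -- nonnegative.
    have hne : ∃ z, z ∈ U := by
      clear ih hg
      induction L generalizing p with
      | nil => exact ⟨_, hp 0 (by simp)⟩
      | cons j L ih => exact ih fun l hl => by simpa using hp l hl 0 (by simp)
    obtain ⟨z, hz⟩ := hne
    have hM : 0 ≤ M := (norm_nonneg _).trans (hg.bound 0 (Nat.zero_le _) z hz)
    have hv : ‖EuclideanSpace.single i h‖ = h := by simp [abs_of_nonneg hh]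
    refine (MulBound.summation_by_parts (hP i) hP0 (Λ := (P * (1 + c)) ^ L.length * M)
      (Λ' := (P * (1 + c)) ^ L.length * (M * h)) (c := c)
      (a := fun l => TorusBesov.boxSymbol A h g L (p + (l : ℝ) • EuclideanSpace.single i h))
      (fun l hl => ih hg.of_succ (hp l hl)) (fun l hl hl' => ?_) ?_).mono
      (le_of_eq ?_)
    · have hs : p + ((l + 1 : ℤ) : ℝ) • EuclideanSpace.single i h =
          p + (l : ℝ) • EuclideanSpace.single i h + EuclideanSpace.single i h := by
        push_cast; rw [add_smul, one_smul, add_assoc]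
      have h2 := hp (l + 1) hl'
      rw [hs] at h2
      have := ih (hv ▸ hg.increment (EuclideanSpace.single i h)) ((hp l hl).inter h2)
      refine this.congr fun k => ?_
      rw [hs, boxSymbol_increment]
    · calc _ = (P * (1 + c)) ^ L.length * M * (2 * A * h) := by ring
        _ ≤ (P * (1 + c)) ^ L.length * M * c := by gcongr
        _ = _ := by ring
    · simp only [List.length_cons, pow_succ]; ring

/-- A function with three bounded derivatives, sampled on a frequency box. -/
theorem MulBound.of_derivBound {A : ℕ} {P c h : ℝ} (hP0 : 0 ≤ P) (hc : 0 ≤ c) (hh : 0 ≤ h)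
    (hP : ∀ (i : Fin 3) (a : ℤ) (n : ℕ), n ≤ 2 * A + 1 →
      MulBound (fun k => if a ≤ k i ∧ k i < a + n then 1 else 0) P) (hA : 2 * A * h ≤ c)
    {M : ℝ} {U : Set Freq} {g : Freq → ℝ} (hg : DerivBound 3 M U g)
    (hU : ∀ k : Fin 3 → ℤ, (∀ i, |k i| ≤ A) → h • latticePoint k ∈ U) :
    MulBound (fun k => if ∀ i, |k i| ≤ A then g (h • latticePoint k) else 0)
      ((P * (1 + c)) ^ 3 * M) := by
  have hz : ∀ k : Fin 3 → ℤ, (0 : Freq) + (k 0 : ℝ) • EuclideanSpace.single 0 h +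
      (k 1 : ℝ) • EuclideanSpace.single 1 h + (k 2 : ℝ) • EuclideanSpace.single 2 h =
      h • latticePoint k := by
    intro k
    ext i
    fin_cases i <;> simp [latticePoint, mul_comm]
  refine (MulBound.boxSymbol hP0 hc hh hP hA [0, 1, 2] hg (p := 0) ?_).congr fun k => ?_
  · intro l₀ h₀ l₁ h₁ l₂ h₂
    have := hU ![l₀, l₁, l₂] (by intro i; fin_cases i <;> simpa)
    rw [← hz] at this
    simpa [GridSubset] using this
  · simp only [TorusBesov.boxSymbol, hz, Fin.forall_fin_succ, Fin.forall_fin_zero]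
    simp only [ite_and]
    rfl

/-! ### Derivatives of products and exponentials -/

theorem norm_iteratedFDeriv_mul_le_of_bound {n : ℕ} {f g : Freq → ℝ} {x : Freq} {a b : ℝ}
    (hf : ContDiffAt ℝ n f x) (hg : ContDiffAt ℝ n g x)
    (ha : ∀ i ≤ n, ‖iteratedFDeriv ℝ i f x‖ ≤ a) (hb : ∀ i ≤ n, ‖iteratedFDeriv ℝ i g x‖ ≤ b) :
    ∀ m ≤ n, ‖iteratedFDeriv ℝ m (fun z => f z * g z) x‖ ≤ 2 ^ n * a * b := by
  intro m hm
  obtain ⟨u, hu, hfu⟩ := hf.contDiffOn le_rfl (by simp)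
  obtain ⟨v, hv, hgv⟩ := hg.contDiffOn le_rfl (by simp)
  obtain ⟨w, hw, hwo, hxw⟩ := mem_nhds_iff.mp (Filter.inter_mem hu hv)
  have ha0 : 0 ≤ a := (norm_nonneg _).trans (ha 0 (Nat.zero_le _))
  have hb0 : 0 ≤ b := (norm_nonneg _).trans (hb 0 (Nat.zero_le _))
  have := norm_iteratedFDerivWithin_mul_le (hfu.mono fun y hy => (hw hy).1)
    (hgv.mono fun y hy => (hw hy).2) hwo.uniqueDiffOn hxw (n := m) (by exact_mod_cast hm)
  simp only [iteratedFDerivWithin_of_isOpen _ hwo hxw] at this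
  refine this.trans ?_
  calc _ ≤ ∑ i ∈ Finset.range (m + 1), (m.choose i : ℝ) * a * b := by
        refine Finset.sum_le_sum fun i hi => ?_
        have := Finset.mem_range.mp hi
        gcongr
        · exact ha i (by omega)
        · exact hb _ (by omega)
    _ = 2 ^ m * a * b := by
        rw [← Finset.sum_mul, ← Finset.sum_mul, ← Nat.cast_sum, Nat.sum_range_choose]
        push_cast; ring
    _ ≤ _ := by gcongr; norm_num

theorem norm_iteratedFDeriv_exp_le_of_bound {n : ℕ} {w : Freq → ℝ} {x : Freq} {K : ℝ}
    (hw : ContDiffAt ℝ n w x) (hK : ∀ i ≤ n, ‖iteratedFDeriv ℝ i w x‖ ≤ K) :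
    ∀ m ≤ n, ‖iteratedFDeriv ℝ m (fun z => Real.exp (w z)) x‖ ≤
      n.factorial * Real.exp (w x) * (1 + K) ^ n := by
  intro m hm
  obtain ⟨u, hu, hwu⟩ := hw.contDiffOn le_rfl (by simp)
  obtain ⟨v, hv, hvo, hxv⟩ := mem_nhds_iff.mp hu
  have hK0 : 0 ≤ K := (norm_nonneg _).trans (hK 0 (Nat.zero_le _))
  have h1 : ∀ i, ‖iteratedFDeriv ℝ i Real.exp (w x)‖ = Real.exp (w x) := fun i => by
    rw [norm_iteratedFDeriv_eq_norm_iteratedDeriv, iteratedDeriv_eq_iterate, Real.iter_deriv_exp,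
      Real.norm_of_nonneg (Real.exp_pos _).le]
  have := norm_iteratedFDerivWithin_comp_le (g := Real.exp) (t := Set.univ) (n := m) (N := n)
    (C := Real.exp (w x)) (D := 1 + K) Real.contDiff_exp.contDiffOn (hwu.mono hv)
    (by exact_mod_cast hm) uniqueDiffOn_univ hvo.uniqueDiffOn (Set.mapsTo_univ _ _) hxv
    (fun i _ => by rw [iteratedFDerivWithin_univ, h1])
    (fun i hi him => by
      rw [iteratedFDerivWithin_of_isOpen _ hvo hxv]
      refine (hK i (him.trans hm)).trans ?_
      calc K ≤ (1 + K) ^ 1 := by linarith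
        _ ≤ _ := pow_le_pow_right₀ (by linarith) hi)
  rw [iteratedFDerivWithin_of_isOpen _ hvo hxv] at this
  refine this.trans ?_
  gcongr
  · linarith

/-- Differentiating the exponential costs at most powers of `1 + TK ≤ (1 + K)(1 + T)`, so all
dependence on `T` is gathered in `(1 + T)^n exp(-cT)`. -/
theorem norm_iteratedFDeriv_mul_exp_le {n : ℕ} {f g : Freq → ℝ} {x : Freq} {a K c T : ℝ}
    (hf : ContDiffAt ℝ n f x) (hg : ContDiffAt ℝ n g x)
    (ha : ∀ i ≤ n, ‖iteratedFDeriv ℝ i f x‖ ≤ a) (hK : ∀ i ≤ n, ‖iteratedFDeriv ℝ i g x‖ ≤ K)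
    (hc : c ≤ g x) (hT : 0 ≤ T) :
    ∀ m ≤ n, ‖iteratedFDeriv ℝ m (fun z => f z * Real.exp (-(T * g z))) x‖ ≤
      2 ^ n * n.factorial * (1 + K) ^ n * a * ((1 + T) ^ n * Real.exp (-(c * T))) := by
  intro m hm
  have ha0 : 0 ≤ a := (norm_nonneg _).trans (ha 0 (Nat.zero_le _))
  have hK0 : 0 ≤ K := (norm_nonneg _).trans (hK 0 (Nat.zero_le _))
  have e : (fun z => -(T * g z)) = (-T) • g := by
    funext z; simp
  have hg' : ContDiffAt ℝ n (fun z => -(T * g z)) x := (contDiffAt_const.mul hg).neg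
  have h1 := norm_iteratedFDeriv_exp_le_of_bound (K := T * K) hg' fun i hi => by
    rw [e, iteratedFDeriv_const_smul_apply (hg.of_le (by exact_mod_cast hi)), norm_smul, norm_neg,
      Real.norm_of_nonneg hT]
    exact mul_le_mul_of_nonneg_left (hK i hi) hT
  refine (norm_iteratedFDeriv_mul_le_of_bound hf (Real.contDiff_exp.contDiffAt.comp x hg') ha h1
    m hm).trans ?_
  have h2 : -(T * g x) ≤ -(c * T) := by nlinarith
  have h3 : 1 + T * K ≤ (1 + K) * (1 + T) := by nlinarith
  calc _ ≤ 2 ^ n * a * (n.factorial * Real.exp (-(c * T)) * ((1 + K) * (1 + T)) ^ n) := by gcongr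
    _ = _ := by rw [mul_pow]; ring

/-- Since `T^(δ/2) ≤ (1 + T)^p` for an integer `p ≥ δ/2`, it is enough to bound `(1 + T)^(n+p)` by
`exp(c(1 + T))` through one term of the exponential series; the factor `exp c` pays for the shift.
-/
theorem exists_pow_mul_exp_le {c : ℝ} (hc : 0 < c) {δ : ℝ} (hδ : 0 ≤ δ) (n : ℕ) :
    ∃ C : ℝ, 0 < C ∧ ∀ T : ℝ, 0 < T →
      (1 + T) ^ n * Real.exp (-(c * T)) ≤ C * T ^ (-δ / 2) := by
  obtain ⟨p, hp⟩ := exists_nat_ge (δ / 2)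
  refine ⟨(n + p).factorial / c ^ (n + p) * Real.exp c, by positivity, fun T hT => ?_⟩
  have h1 : T ^ (δ / 2) ≤ (1 + T) ^ p := by
    rw [← Real.rpow_natCast]
    exact (Real.rpow_le_rpow hT.le (by linarith) (by linarith)).trans
      (Real.rpow_le_rpow_of_exponent_le (by linarith) hp)
  have h2 := Real.pow_div_factorial_le_exp (c * (1 + T)) (by positivity) (n + p)
  have h3 : T ^ (-δ / 2) = (T ^ (δ / 2))⁻¹ := by
    rw [← Real.rpow_neg hT.le]; congr 1; ring
  rw [h3, ← div_eq_mul_inv, le_div_iff₀ (by positivity)]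
  calc _ ≤ (1 + T) ^ n * Real.exp (-(c * T)) * (1 + T) ^ p := by gcongr
    _ = (n + p).factorial / c ^ (n + p) * Real.exp (-(c * T)) *
        ((c * (1 + T)) ^ (n + p) / (n + p).factorial) := by
        rw [mul_pow, pow_add (1 + T)]; field_simp
    _ ≤ (n + p).factorial / c ^ (n + p) * Real.exp (-(c * T)) * Real.exp (c * (1 + T)) := by gcongr
    _ = _ := by rw [mul_assoc, ← Real.exp_add]; congr 2; ring

theorem exists_iteratedFDeriv_bound {f : Freq → ℝ} (hf : ContDiff ℝ ∞ f) (R : ℝ) (n : ℕ) :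
    ∃ b : ℝ, 0 ≤ b ∧ ∀ i ≤ n, ∀ x, ‖x‖ ≤ R → ‖iteratedFDeriv ℝ i f x‖ ≤ b := by
  have h1 : ∀ i : ℕ, ∃ B, ∀ x ∈ Metric.closedBall (0 : Freq) R, ‖iteratedFDeriv ℝ i f x‖ ≤ B :=
    fun i => (isCompact_closedBall _ _).exists_bound_of_continuousOn
      (hf.continuous_iteratedFDeriv (by exact_mod_cast le_top)).continuousOn
  choose B hB using h1
  refine ⟨∑ i ∈ Finset.range (n + 1), |B i|, by positivity, fun i hi x hx => ?_⟩
  refine (hB i x (by simpa using hx)).trans ((le_abs_self _).trans ?_)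
  exact Finset.single_le_sum (f := fun i => |B i|) (fun _ _ => abs_nonneg _)
    (Finset.mem_range.mpr (by omega))

/-- Away from the support of a factor there is nothing to check. -/
theorem DerivBound.mul_of_tsupport {n : ℕ} {M : ℝ} (hM : 0 ≤ M) {U : Set Freq} (hU : IsOpen U)
    (hU' : Convex ℝ U) {f g : Freq → ℝ}
    (h : ∀ z ∈ U, z ∈ tsupport f → ContDiffAt ℝ n (fun z => f z * g z) z ∧
      ∀ m ≤ n, ‖iteratedFDeriv ℝ m (fun z => f z * g z) z‖ ≤ M) :
    DerivBound n M U (fun z => f z * g z) := by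
  have h0 : ∀ z, z ∉ tsupport f → (fun z => f z * g z) =ᶠ[𝓝 z] fun _ => 0 := fun z hz => by
    filter_upwards [notMem_tsupport_iff_eventuallyEq.mp hz] with y hy
    rw [hy]; simp
  refine ⟨hU, hU', fun z hz => ?_, fun m hm z hz => ?_⟩
  · by_cases hs : z ∈ tsupport f
    · exact (h z hz hs).1
    · exact contDiffAt_const.congr_of_eventuallyEq (h0 z hs)
  · by_cases hs : z ∈ tsupport f
    · exact (h z hz hs).2 m hm
    · rw [((h0 z hs).iteratedFDeriv ℝ m).eq_of_nhds]
      simpa using hM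

/-- The symbol of the heat semigroup on a dyadic annulus. -/
theorem exists_derivBound_heat {ϑ : Freq → ℝ} (hϑ : ContDiff ℝ ∞ ϑ) {r R : ℝ} (hr : 0 < r)
    (hs : tsupport ϑ ⊆ {z | r ≤ ‖z‖ ∧ ‖z‖ ≤ R}) {δ : ℝ} (hδ : 0 ≤ δ) :
    ∃ C : ℝ, 0 < C ∧ ∀ T : ℝ, 0 < T → DerivBound 3 (C * T ^ (-δ / 2)) Set.univ
      (fun z => ϑ z * Real.exp (-(T * ‖z‖ ^ 2))) := by
  obtain ⟨b, hb0, hb⟩ := exists_iteratedFDeriv_bound hϑ R 3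
  obtain ⟨q, hq0, hq⟩ := exists_iteratedFDeriv_bound (f := fun z : Freq => ‖z‖ ^ 2)
    (contDiff_norm_sq ℝ) R 3
  obtain ⟨C, hC0, hC⟩ := exists_pow_mul_exp_le (c := r ^ 2) (by positivity) hδ 3
  set D := 2 ^ 3 * ((3 : ℕ).factorial : ℝ) * (1 + q) ^ 3 * b
  have hD : 0 ≤ D := by positivity
  refine ⟨(D + 1) * C, by positivity, fun T hT => ?_⟩
  refine DerivBound.mul_of_tsupport (by positivity) isOpen_univ convex_univ fun z _ hz => ?_
  have hz := hs hz
  have hcϑ : ContDiffAt ℝ (3 : ℕ) ϑ z := (contDiff_infty.mp hϑ 3).contDiffAt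
  have hcq : ContDiffAt ℝ (3 : ℕ) (fun z : Freq => ‖z‖ ^ 2) z := (contDiff_norm_sq ℝ).contDiffAt
  refine ⟨hcϑ.mul (Real.contDiff_exp.contDiffAt.comp z (contDiffAt_const.mul hcq).neg),
    fun m hm => ?_⟩
  refine (norm_iteratedFDeriv_mul_exp_le hcϑ hcq (fun i hi => hb i hi z hz.2)
    (fun i hi => hq i hi z hz.2) (c := r ^ 2) (pow_le_pow_left₀ hr.le hz.1 2) hT.le m hm).trans ?_
  calc D * ((1 + T) ^ 3 * Real.exp (-(r ^ 2 * T))) ≤ (D + 1) * (C * T ^ (-δ / 2)) :=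
        mul_le_mul (by linarith) (hC T hT) (by positivity) (by positivity)
    _ = _ := by ring

/-! ### The approximated symbol near a dyadic annulus -/

theorem isOpen_cube (L : ℝ) : IsOpen {x : Freq | ∀ i, |x i| < L} := by
  rw [Set.ofPred_forall]
  exact isOpen_iInter_of_finite fun i => isOpen_lt (by fun_prop) continuous_const

theorem isOpen_punctured_cube (L : ℝ) : IsOpen {x : Freq | x ≠ 0 ∧ ∀ i, |x i| < L} :=
  isOpen_ne.inter (isOpen_cube L)

/-- The first-order derivative bound does not blow up at the origin, so `f̃` is Lipschitz along
rays, and `f̃(0) = 1` gives the linear smallness. Subtracting 1 does not affect the higher orders.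
-/
theorem IsAdmissible.exists_sub_one_bound {L₀ : ℝ} {ftilde : Freq → ℝ}
    (hf : IsAdmissible L₀ ftilde) : ∃ C : ℝ, 0 ≤ C ∧ ∀ x : Freq, x ≠ 0 → (∀ i, |x i| < 3 * L₀) →
      |ftilde x - 1| ≤ C * ‖x‖ ∧ ∀ m : ℕ, 1 ≤ m → m ≤ 3 →
        ‖iteratedFDeriv ℝ m (fun y => ftilde y - 1) x‖ ≤ C * (‖x‖ ^ (1 - (m : ℤ)) + 1) := by
  obtain ⟨C, hC⟩ := hf.deriv_bound
  refine ⟨2 * |C|, by positivity, fun x hx hx' => ⟨?_, fun m hm hm' => ?_⟩⟩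
  · have hseg : ∀ s : ℝ, 0 < s → s ≤ 1 → |ftilde x - ftilde (s • x)| ≤ 2 * |C| * ‖x‖ := by
      intro s hs hs1
      have hsub : ∀ y ∈ segment ℝ (s • x) x, y ≠ 0 ∧ ∀ i, |y i| < 3 * L₀ := by
        rintro y ⟨a, b, ha, hb, hab, rfl⟩
        have hp : 0 < a * s + b := by nlinarith
        have hp1 : a * s + b ≤ 1 := by nlinarith
        rw [smul_smul, ← add_smul]
        refine ⟨smul_ne_zero hp.ne' hx, fun i => ?_⟩
        rw [PiLp.smul_apply, smul_eq_mul, abs_mul, abs_of_pos hp]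
        exact (mul_le_of_le_one_left (abs_nonneg _) hp1).trans_lt (hx' i)
      have := (convex_segment (s • x) x).norm_image_sub_le_of_norm_fderiv_le (𝕜 := ℝ)
        (f := ftilde) (C := 2 * |C|) (fun y hy =>
          (hf.contDiffOn.contDiffAt ((isOpen_punctured_cube _).mem_nhds (hsub y hy))).differentiableAt
            (by norm_num))
        (fun y hy => by
          have h := hC 1 (by norm_num) y (hsub y hy).1 (hsub y hy).2
          rw [norm_iteratedFDeriv_one] at h
          norm_num at h
          linarith [le_abs_self C]) (left_mem_segment ℝ _ _) (right_mem_segment ℝ _ _)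
      refine this.trans (mul_le_mul_of_nonneg_left ?_ (by positivity))
      have e : x - s • x = (1 - s) • x := by rw [sub_smul, one_smul]
      rw [e, norm_smul, Real.norm_of_nonneg (by linarith)]
      exact mul_le_of_le_one_left (norm_nonneg _) (by linarith)
    have hlim : Filter.Tendsto (fun s : ℝ => |ftilde x - ftilde (s • x)|) (𝓝[>] 0)
        (𝓝 |ftilde x - 1|) := by
      have h1 : Filter.Tendsto (fun s : ℝ => s • x) (𝓝[>] 0) (𝓝 0) := by
        have : Filter.Tendsto (fun s : ℝ => s • x) (𝓝 0) (𝓝 ((0 : ℝ) • x)) :=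
          (continuous_id.smul continuous_const).tendsto 0
        rw [zero_smul] at this
        exact this.mono_left nhdsWithin_le_nhds
      have h2 := hf.continuousAt_zero.tendsto.comp h1
      rw [hf.map_zero] at h2
      exact (tendsto_const_nhds.sub h2).abs
    refine le_of_tendsto hlim ?_
    filter_upwards [Ioc_mem_nhdsGT (zero_lt_one' ℝ)] with s hs
    exact hseg s hs.1 hs.2
  · have hcd : ContDiffAt ℝ m ftilde x :=
      (hf.contDiffOn.contDiffAt ((isOpen_punctured_cube _).mem_nhds ⟨hx, hx'⟩)).of_le
        (by exact_mod_cast hm'.trans (by norm_num))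
    have := iteratedFDeriv_sub_apply hcd (contDiffAt_const (c := (1 : ℝ)))
    rw [iteratedFDeriv_const_of_ne (by omega), Pi.zero_apply, sub_zero] at this
    change ‖iteratedFDeriv ℝ m (ftilde - fun _ => 1) x‖ ≤ _
    rw [this]
    refine (hC m (by omega) x hx hx').trans ?_
    have : 0 ≤ ‖x‖ ^ (1 - (m : ℤ)) + 1 := by positivity
    gcongr
    linarith [le_abs_self C, abs_nonneg C]

theorem norm_iteratedFDeriv_comp_smul_le {g : Freq → ℝ} {W : Set Freq} (hW : IsOpen W) {n : ℕ}
    (hg : ContDiffOn ℝ n g W) {e : ℝ} {z : Freq} (hz : e • z ∈ W) {m : ℕ} (hm : m ≤ n) :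
    ‖iteratedFDeriv ℝ m (fun y => g (e • y)) z‖ ≤ ‖iteratedFDeriv ℝ m g (e • z)‖ * |e| ^ m := by
  set L : Freq →L[ℝ] Freq := e • ContinuousLinearMap.id ℝ Freq
  have hL : ‖L‖ ≤ |e| := by
    refine ContinuousLinearMap.opNorm_le_bound _ (abs_nonneg _) fun y => ?_
    change ‖e • y‖ ≤ _
    rw [norm_smul, Real.norm_eq_abs]
  have ho : IsOpen (L ⁻¹' W) := hW.preimage L.continuous
  have := L.iteratedFDerivWithin_comp_right hg hW.uniqueDiffOn ho.uniqueDiffOn (x := z) hz (i := m)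
    (by exact_mod_cast hm)
  rw [iteratedFDerivWithin_of_isOpen _ ho hz,
    iteratedFDerivWithin_of_isOpen _ hW (show L z ∈ W from hz)] at this
  change ‖iteratedFDeriv ℝ m (g ∘ L) z‖ ≤ _
  rw [this]
  refine (ContinuousMultilinearMap.norm_compContinuousLinearMap_le _ _).trans ?_
  rw [Finset.prod_const, Finset.card_univ, Fintype.card_fin]
  change ‖iteratedFDeriv ℝ m g (e • z)‖ * _ ≤ _
  gcongr

theorem contDiffOn_sub_one {L₀ : ℝ} {ftilde : Freq → ℝ} (hf : IsAdmissible L₀ ftilde) :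
    ContDiffOn ℝ (3 : ℕ) (fun y => ftilde y - 1) {x : Freq | x ≠ 0 ∧ ∀ i, |x i| < 3 * L₀} :=
  (hf.contDiffOn.sub contDiffOn_const).of_le (by norm_num)

/-- On an annulus, `f̃(e z) - 1` has three derivatives of size `e`. -/
theorem IsAdmissible.exists_scaled_bound {L₀ : ℝ} {ftilde : Freq → ℝ}
    (hf : IsAdmissible L₀ ftilde) {r : ℝ} (hr : 0 < r) (R E : ℝ) :
    ∃ K : ℝ, 0 ≤ K ∧ ∀ e : ℝ, 0 < e → e ≤ E → ∀ z : Freq, r ≤ ‖z‖ → ‖z‖ ≤ R →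
      (∀ i, |(e • z) i| < 3 * L₀) → ∀ m ≤ 3,
        ‖iteratedFDeriv ℝ m (fun y => ftilde (e • y) - 1) z‖ ≤ K * e := by
  obtain ⟨C, hC0, hC⟩ := hf.exists_sub_one_bound
  refine ⟨C * (|R| + (1 + r⁻¹) ^ 2 + (1 + E) ^ 2), by positivity,
    fun e he heE z hrz hzR hz m hm => ?_⟩
  have hz0 : 0 < ‖z‖ := hr.trans_le hrz
  have hez : e • z ≠ 0 := smul_ne_zero he.ne' (norm_pos_iff.mp hz0)
  have hn : ‖e • z‖ = e * ‖z‖ := by rw [norm_smul, Real.norm_of_nonneg he.le]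
  obtain ⟨h0, h1⟩ := hC _ hez hz
  have hE : 0 < E := he.trans_le heE
  have hr' : 0 < r⁻¹ := inv_pos.mpr hr
  have hR : ‖z‖ ≤ |R| := hzR.trans (le_abs_self _)
  rcases Nat.eq_zero_or_pos m with rfl | hm1
  · rw [norm_iteratedFDeriv_zero, Real.norm_eq_abs]
    rw [hn] at h0
    calc _ ≤ C * (e * ‖z‖) := h0
      _ = C * ‖z‖ * e := by ring
      _ ≤ _ := by gcongr; nlinarith [sq_nonneg (1 + r⁻¹), sq_nonneg (1 + E)]
  · refine (norm_iteratedFDeriv_comp_smul_le (isOpen_punctured_cube _) (contDiffOn_sub_one hf)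
      ⟨hez, hz⟩ hm).trans ?_
    have hb := h1 m hm1 hm
    obtain ⟨p, rfl⟩ : ∃ p, m = p + 1 := ⟨m - 1, by omega⟩
    have e1 : ‖e • z‖ ^ (1 - ((p + 1 : ℕ) : ℤ)) = ((e * ‖z‖) ^ p)⁻¹ := by
      rw [hn, show 1 - ((p + 1 : ℕ) : ℤ) = -(p : ℤ) by push_cast; ring, zpow_neg, zpow_natCast]
    rw [e1] at hb
    have e2 : (‖z‖⁻¹) ^ p ≤ (1 + r⁻¹) ^ 2 := by
      have : ‖z‖⁻¹ ≤ 1 + r⁻¹ := (inv_anti₀ hr hrz).trans (by linarith)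
      exact (pow_le_pow_left₀ (by positivity) this p).trans
        (pow_le_pow_right₀ (by linarith) (by omega))
    have e3 : e ^ p ≤ (1 + E) ^ 2 :=
      (pow_le_pow_left₀ he.le (show e ≤ 1 + E by linarith) p).trans
        (pow_le_pow_right₀ (by linarith) (by omega))
    rw [abs_of_pos he]
    calc _ ≤ C * (((e * ‖z‖) ^ p)⁻¹ + 1) * e ^ (p + 1) := by gcongr
      -- The `p + 1` factors `e` of the chain rule beat the singularity `(e‖z‖)^(-p)` with exactly
      -- one `e` to spare.
      _ = C * ((‖z‖⁻¹) ^ p + e ^ p) * e := by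
        rw [mul_pow, inv_pow]; field_simp; ring
      _ ≤ _ := by
        gcongr
        linarith [abs_nonneg R]

theorem norm_le_of_forall_abs_lt {z : Freq} {b : ℝ} (h : ∀ i, |z i| < b) : ‖z‖ ≤ 3 * b := by
  have hb : 0 ≤ b := (abs_nonneg _).trans (h 0).le
  rw [EuclideanSpace.norm_eq, Real.sqrt_le_left (by positivity)]
  calc ∑ i, ‖z i‖ ^ 2 ≤ ∑ _i : Fin 3, b ^ 2 := by
        refine Finset.sum_le_sum fun i _ => ?_
        rw [Real.norm_eq_abs]
        exact pow_le_pow_left₀ (abs_nonneg _) (h i).le 2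
    _ ≤ _ := by simp; nlinarith [sq_nonneg b]

/-- The symbol of the approximated semigroup depends on the interpolation parameter `s` in a
controlled way: the derivative in `s` of the symbol
`exp(-T|z|²(1 + s(f̃(ez) - 1)))` is of order `e^η T^{-δ/2}`. -/
theorem exists_derivBound_interpolation {L₀ : ℝ} {ftilde : Freq → ℝ} (hL₀ : 0 < L₀)
    (hf : IsAdmissible L₀ ftilde) {ϑ : Freq → ℝ} (hϑ : ContDiff ℝ ∞ ϑ) {r R : ℝ} (hr : 0 < r)
    (hs : tsupport ϑ ⊆ {z | r ≤ ‖z‖ ∧ ‖z‖ ≤ R}) {δ η : ℝ} (hδ : 0 ≤ δ) (hη : η < 1) :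
    ∃ C : ℝ, 0 < C ∧ ∀ e T s : ℝ, 0 < e → 0 < T → 0 ≤ s → s ≤ 1 →
      DerivBound 3 (C * (e ^ η * T ^ (-δ / 2))) {z | ∀ i, |(e • z) i| < 3 * L₀}
        (fun z => ϑ z * (-(T * (‖z‖ ^ 2 * (ftilde (e • z) - 1))) *
          Real.exp (-(T * (‖z‖ ^ 2 + s * (‖z‖ ^ 2 * (ftilde (e • z) - 1))))))) := by
  -- On the annulus `‖z‖ ≥ r`, the condition that `e • z` lies in the cube forces `e ≤ E`.
  set E := 3 * (3 * L₀) / r with hE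
  have hE0 : 0 < E := by positivity
  obtain ⟨c, hc0, hc⟩ := hf.lower_bound
  obtain ⟨K, hK0, hK⟩ := hf.exists_scaled_bound hr R E
  obtain ⟨b, hb0, hb⟩ := exists_iteratedFDeriv_bound hϑ R 3
  obtain ⟨q, hq0, hq⟩ := exists_iteratedFDeriv_bound (f := fun z : Freq => ‖z‖ ^ 2)
    (contDiff_norm_sq ℝ) R 3
  have hc' : 0 < r ^ 2 * min 1 c := by positivity
  obtain ⟨C, hC0, hC⟩ := exists_pow_mul_exp_le hc' hδ 4
  set k := 2 ^ 3 * q * K with hk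
  set D := 2 ^ 3 * ((3 : ℕ).factorial : ℝ) * (1 + (q + k * E)) ^ 3 * (2 ^ 3 * b * k) with hD
  have hk0 : 0 ≤ k := by positivity
  have hD0 : 0 ≤ D := by positivity
  refine ⟨(D + 1) * E ^ (1 - η) * C, by positivity, fun e T s he hT hs0 hs1 => ?_⟩
  -- The domain must be convex and so contains the origin, where `f̃` may be singular; `ϑ` vanishes
  -- near that point.
  refine DerivBound.mul_of_tsupport (by positivity) ?_ ?_ fun z hz hzs => ?_
  · exact (isOpen_cube (3 * L₀)).preimage (continuous_const_smul e)
  · intro x hx y hy a b ha hb hab i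
    have h1 := hx i
    have h2 := hy i
    have h3 : (e • (a • x + b • y)) i = a * (e • x) i + b * (e • y) i := by
      simp; ring
    rw [h3]
    rw [abs_lt] at h1 h2 ⊢
    constructor
    · rcases ha.eq_or_lt with rfl | ha
      · simp at hab; subst hab; linarith
      · nlinarith
    · rcases ha.eq_or_lt with rfl | ha
      · simp at hab; subst hab; linarith
      · nlinarith
  have hzA := hs hzs
  have hz0 : 0 < ‖z‖ := hr.trans_le hzA.1
  have heE : e ≤ E := by
    have := norm_le_of_forall_abs_lt hz
    rw [norm_smul, Real.norm_of_nonneg he.le] at this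
    rw [hE, le_div_iff₀ hr]
    exact (mul_le_mul_of_nonneg_left hzA.1 he.le).trans this
  have hmem : e • z ∈ {x : Freq | x ≠ 0 ∧ ∀ i, |x i| < 3 * L₀} :=
    ⟨smul_ne_zero he.ne' (norm_pos_iff.mp hz0), hz⟩
  have cϑ : ContDiffAt ℝ (3 : ℕ) ϑ z := (contDiff_infty.mp hϑ 3).contDiffAt
  have cq : ContDiffAt ℝ (3 : ℕ) (fun z : Freq => ‖z‖ ^ 2) z := (contDiff_norm_sq ℝ).contDiffAt
  have cg : ContDiffAt ℝ (3 : ℕ) (fun y => ftilde (e • y) - 1) z :=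
    ((contDiffOn_sub_one hf).contDiffAt ((isOpen_punctured_cube _).mem_nhds hmem)).comp z
      (f := fun y => e • y) (by fun_prop)
  have cψ : ContDiffAt ℝ (3 : ℕ) (fun y => ‖y‖ ^ 2 * (ftilde (e • y) - 1)) z := cq.mul cg
  have bψ : ∀ i ≤ 3, ‖iteratedFDeriv ℝ i (fun y => ‖y‖ ^ 2 * (ftilde (e • y) - 1)) z‖ ≤ k * e := by
    intro i hi
    refine (norm_iteratedFDeriv_mul_le_of_bound cq cg (fun i hi => hq i hi z hzA.2)
      (hK e he heE z hzA.1 hzA.2 hz) i hi).trans (le_of_eq ?_)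
    rw [hk]; ring
  have bsmul : ∀ a : ℝ, ∀ i ≤ 3,
      ‖iteratedFDeriv ℝ i (fun y => a * (‖y‖ ^ 2 * (ftilde (e • y) - 1))) z‖ ≤ |a| * (k * e) := by
    intro a i hi
    change ‖iteratedFDeriv ℝ i (a • fun y => ‖y‖ ^ 2 * (ftilde (e • y) - 1)) z‖ ≤ _
    rw [iteratedFDeriv_const_smul_apply (cψ.of_le (by exact_mod_cast hi)), norm_smul,
      Real.norm_eq_abs]
    exact mul_le_mul_of_nonneg_left (bψ i hi) (abs_nonneg _)
  have cA : ContDiffAt ℝ (3 : ℕ) (fun y => ϑ y * (-T * (‖y‖ ^ 2 * (ftilde (e • y) - 1)))) z :=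
    cϑ.mul (contDiffAt_const.mul cψ)
  have bA := norm_iteratedFDeriv_mul_le_of_bound cϑ (contDiffAt_const.mul cψ)
    (fun i hi => hb i hi z hzA.2) (bsmul (-T))
  have cB : ContDiffAt ℝ (3 : ℕ)
      (fun y => ‖y‖ ^ 2 + s * (‖y‖ ^ 2 * (ftilde (e • y) - 1))) z :=
    cq.add (contDiffAt_const.mul cψ)
  have bB : ∀ i ≤ 3, ‖iteratedFDeriv ℝ i
      (fun y => ‖y‖ ^ 2 + s * (‖y‖ ^ 2 * (ftilde (e • y) - 1))) z‖ ≤ q + k * E := by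
    intro i hi
    change ‖iteratedFDeriv ℝ i
      ((fun y => ‖y‖ ^ 2) + fun y => s * (‖y‖ ^ 2 * (ftilde (e • y) - 1))) z‖ ≤ _
    rw [iteratedFDeriv_add_apply (cq.of_le (by exact_mod_cast hi))
      ((contDiffAt_const.mul cψ).of_le (by exact_mod_cast hi))]
    refine (norm_add_le _ _).trans (add_le_add (hq i hi z hzA.2) ((bsmul s i hi).trans ?_))
    rw [abs_of_nonneg hs0]
    calc s * (k * e) ≤ 1 * (k * E) := by gcongr
      _ = _ := one_mul _
  -- The factor `1 + s(f̃ - 1)` is a convex combination of 1 and `f̃ ≥ c`, so exponential decay is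
  -- uniform in `s`.
  have lB : r ^ 2 * min 1 c ≤ ‖z‖ ^ 2 + s * (‖z‖ ^ 2 * (ftilde (e • z) - 1)) := by
    have h1 : min 1 c ≤ 1 + s * (ftilde (e • z) - 1) := by
      have h2 := hc _ hz
      have h3 := min_le_left 1 c
      have h4 := min_le_right 1 c
      nlinarith
    calc _ ≤ ‖z‖ ^ 2 * (1 + s * (ftilde (e • z) - 1)) := by
          have := hzA.1
          gcongr
      _ = _ := by ring
  have e0 : (fun z => ϑ z * (-(T * (‖z‖ ^ 2 * (ftilde (e • z) - 1))) *
      Real.exp (-(T * (‖z‖ ^ 2 + s * (‖z‖ ^ 2 * (ftilde (e • z) - 1))))))) =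
      fun z => (ϑ z * (-T * (‖z‖ ^ 2 * (ftilde (e • z) - 1)))) *
        Real.exp (-(T * (‖z‖ ^ 2 + s * (‖z‖ ^ 2 * (ftilde (e • z) - 1))))) := by
    funext z; ring
  rw [e0]
  refine ⟨cA.mul (Real.contDiff_exp.contDiffAt.comp z (contDiffAt_const.mul cB).neg),
    fun m hm => ?_⟩
  refine (norm_iteratedFDeriv_mul_exp_le cA cB bA bB lB hT.le m hm).trans ?_
  have h1 : e ≤ E ^ (1 - η) * e ^ η := by
    calc e = e ^ (1 - η) * e ^ η := by rw [← Real.rpow_add he]; simp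
      _ ≤ _ := by gcongr
  -- The prefactor `T` from the `s`-derivative is the reason for the fourth power in the choice of
  -- `C`.
  have h2 : T * (1 + T) ^ 3 ≤ (1 + T) ^ 4 := by
    rw [pow_succ' (1 + T) 3]
    gcongr
    linarith
  rw [abs_neg, abs_of_pos hT]
  calc _ = D * e * ((T * (1 + T) ^ 3) * Real.exp (-(r ^ 2 * min 1 c * T))) := by rw [hD]; ring
    _ ≤ (D + 1) * (E ^ (1 - η) * e ^ η) *
        ((1 + T) ^ 4 * Real.exp (-(r ^ 2 * min 1 c * T))) := by
      refine mul_le_mul ?_ (mul_le_mul_of_nonneg_right h2 (Real.exp_pos _).le) (by positivity)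
        (by positivity)
      exact mul_le_mul (by linarith) h1 he.le (by positivity)
    _ ≤ (D + 1) * (E ^ (1 - η) * e ^ η) * (C * T ^ (-δ / 2)) := by
      have := hC T hT
      gcongr ?_ * ?_
    _ = _ := by ring

/-! ### The difference of the two symbols on a dyadic block -/

open Classical in
/-- The symbol of `P_t^ε - P_t`. -/
def symbolDiff (L₀ : ℝ) (ftilde : Freq → ℝ) (ε t : ℝ) (k : Fin 3 → ℤ) : ℝ :=
  (if ∀ i, |ε * k i| ≤ L₀ then
    Real.exp (-(t * ‖latticePoint k‖ ^ 2 * ftilde (ε • latticePoint k))) else 0) -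
    Real.exp (-(t * ‖latticePoint k‖ ^ 2))

theorem fourierCoeff_sub (u v : Distribution) (k : Fin 3 → ℤ) :
    fourierCoeff (u - v) k = fourierCoeff u k - fourierCoeff v k := rfl

theorem fourierCoeff_approxHeat_sub_heat {L₀ : ℝ} (hL : 0 < L₀) {ftilde : Freq → ℝ}
    (hf : IsAdmissible L₀ ftilde) (ε : ℝ) {t : ℝ} (ht : 0 < t) (u : Distribution)
    (k : Fin 3 → ℤ) : fourierCoeff (approxHeat L₀ ftilde ε t u - heat t u) k =
      (symbolDiff L₀ ftilde ε t k : ℂ) * fourierCoeff u k := by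
  rw [fourierCoeff_sub, fourierCoeff_approxHeat hL hf.nonneg ε ht, fourierCoeff_heat ht.le,
    ← sub_mul, symbolDiff, Complex.ofReal_sub]

theorem symbolDiff_zero {L₀ : ℝ} (hL : 0 < L₀) (ftilde : Freq → ℝ) (ε t : ℝ) :
    symbolDiff L₀ ftilde ε t 0 = 0 := by
  have : latticePoint 0 = 0 := by ext i; simp [latticePoint]
  simp [symbolDiff, this, hL.le]

theorem hasDerivAt_mul_exp_affine (a T b c s : ℝ) :
    HasDerivAt (fun s => a * Real.exp (-(T * (b + s * c))))
      (a * (-(T * c) * Real.exp (-(T * (b + s * c))))) s := by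
  have h := ((((hasDerivAt_id' s).mul_const c).const_add b).const_mul T).fun_neg.exp.const_mul a
  exact h.congr_deriv (by ring)

/-- The interpolation, with parameter `s`, between the symbols of the two semigroups, localised by
`ϑ` at the scale `X` and cut off on a box of size `A`. -/
def interpSymbol (ftilde ϑ : Freq → ℝ) (X ε t : ℝ) (A : ℕ) (s : ℝ) (k : Fin 3 → ℤ) : ℝ :=
  if ∀ i, |k i| ≤ A then
    ϑ (X⁻¹ • latticePoint k) * Real.exp (-(t * X ^ 2 * (‖X⁻¹ • latticePoint k‖ ^ 2 + s *
      (‖X⁻¹ • latticePoint k‖ ^ 2 * (ftilde ((ε * X) • X⁻¹ • latticePoint k) - 1))))) else 0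

theorem smul_inv_smul_latticePoint {X : ℝ} (hX : 0 < X) (ε : ℝ) (k : Fin 3 → ℤ) :
    (ε * X) • X⁻¹ • latticePoint k = ε • latticePoint k := by
  rw [smul_smul, mul_assoc, mul_inv_cancel₀ hX.ne', mul_one]

theorem mul_sq_norm_inv_smul {X : ℝ} (hX : 0 < X) (t : ℝ) (k : Fin 3 → ℤ) :
    t * X ^ 2 * ‖X⁻¹ • latticePoint k‖ ^ 2 = t * ‖latticePoint k‖ ^ 2 := by
  rw [norm_smul, Real.norm_of_nonneg (inv_pos.mpr hX).le]
  field_simp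

theorem abs_le_floor_iff {L₀ ε : ℝ} (hL₀ : 0 < L₀) (hε : 0 < ε) (n : ℤ) :
    |n| ≤ (⌊L₀ / ε⌋₊ : ℤ) ↔ |ε * n| ≤ L₀ := by
  rw [Int.abs_eq_natAbs, Nat.cast_le, Nat.le_floor_iff (by positivity), Nat.cast_natAbs,
    Int.cast_abs, le_div_iff₀' hε, abs_mul, abs_of_pos hε]

theorem interpSymbol_zero (ftilde ϑ : Freq → ℝ) (X ε t : ℝ) (A : ℕ) (k : Fin 3 → ℤ) :
    interpSymbol ftilde ϑ X ε t A 0 k = if ∀ i, |k i| ≤ A then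
      ϑ (X⁻¹ • latticePoint k) * Real.exp (-(t * X ^ 2 * ‖X⁻¹ • latticePoint k‖ ^ 2)) else 0 := by
  simp only [interpSymbol, zero_mul, add_zero]

/-- On the support of `ϑ(X⁻¹ ·)` the cube `|ε k| ≤ L₀` can be replaced by a box of size `O(X)`. -/
theorem mul_symbolDiff_eq {L₀ : ℝ} (hL₀ : 0 < L₀) {ftilde ϑ : Freq → ℝ} {R : ℝ}
    (hs : tsupport ϑ ⊆ {z | ‖z‖ ≤ R}) {X ε : ℝ} (hX : 0 < X) (hε : 0 < ε) (t : ℝ) {A : ℕ}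
    (hA : R * X ≤ A) (k : Fin 3 → ℤ) :
    ϑ (X⁻¹ • latticePoint k) * symbolDiff L₀ ftilde ε t k =
      interpSymbol ftilde ϑ X ε t (min ⌊L₀ / ε⌋₊ A) 1 k - interpSymbol ftilde ϑ X ε t A 0 k := by
  by_cases h0 : ϑ (X⁻¹ • latticePoint k) = 0
  · simp [interpSymbol, h0]
  have hk : ∀ i, |k i| ≤ (A : ℤ) := fun i => by
    have h1 : ‖X⁻¹ • latticePoint k‖ ≤ R := hs (subset_tsupport _ h0)
    rw [norm_smul, Real.norm_of_nonneg (inv_pos.mpr hX).le, inv_mul_le_iff₀ hX] at h1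
    have h2 : |(k i : ℝ)| ≤ ‖latticePoint k‖ := by
      simpa [latticePoint] using PiLp.norm_apply_le (latticePoint k) i
    have h3 : |(k i : ℝ)| ≤ (A : ℝ) := by linarith
    exact_mod_cast h3
  have hiff : (∀ i, |k i| ≤ ((min ⌊L₀ / ε⌋₊ A : ℕ) : ℤ)) ↔ ∀ i, |ε * k i| ≤ L₀ := by
    refine forall_congr' fun i => ?_
    rw [← abs_le_floor_iff hL₀ hε, Nat.cast_min, le_min_iff, and_iff_left (hk i)]
  rw [interpSymbol_zero, if_pos hk, mul_sq_norm_inv_smul hX, symbolDiff, mul_sub]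
  congr 1
  simp only [interpSymbol, hiff, smul_inv_smul_latticePoint hX]
  split_ifs
  · congr 2
    rw [one_mul, ← mul_sq_norm_inv_smul hX]
    ring
  · simp

/-- With `A ≤ ⌊L₀/ε⌋` every sampled frequency satisfies `|ε k i| ≤ L₀ < 3L₀`, so the derivative
bounds of the interpolated symbol apply on the whole grid and can be integrated over `s`. -/
theorem mulBound_interpSymbol_sub {L₀ : ℝ} (hL₀ : 0 < L₀) {ftilde ϑ : Freq → ℝ} {X ε t M : ℝ}
    (hX : 0 < X) (hε : 0 < ε)
    (hM : ∀ s : ℝ, 0 ≤ s → s ≤ 1 → DerivBound 3 M {z | ∀ i, |((ε * X) • z) i| < 3 * L₀}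
      (fun z => ϑ z * (-(t * X ^ 2 * (‖z‖ ^ 2 * (ftilde ((ε * X) • z) - 1))) *
        Real.exp (-(t * X ^ 2 *
          (‖z‖ ^ 2 + s * (‖z‖ ^ 2 * (ftilde ((ε * X) • z) - 1)))))))) {A : ℕ}
    (hA : A ≤ ⌊L₀ / ε⌋₊) {P c : ℝ} (hP0 : 0 ≤ P) (hc : 0 ≤ c)
    (hP : ∀ (i : Fin 3) (a : ℤ) (n : ℕ), n ≤ 2 * A + 1 →
      MulBound (fun k => if a ≤ k i ∧ k i < a + n then 1 else 0) P) (hAc : 2 * A * X⁻¹ ≤ c) :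
    MulBound (fun k => interpSymbol ftilde ϑ X ε t A 1 k - interpSymbol ftilde ϑ X ε t A 0 k)
      ((P * (1 + c)) ^ 3 * M) := by
  refine MulBound.sub_of_hasDerivAt (fun s k => ?_) (fun s hs0 hs1 =>
    MulBound.of_derivBound hP0 hc (inv_pos.mpr hX).le hP hAc (hM s hs0 hs1) fun k hk i => ?_)
  · simp only [interpSymbol]
    split_ifs
    · exact hasDerivAt_mul_exp_affine _ _ _ _ _
    · exact hasDerivAt_const _ _
  · rw [smul_inv_smul_latticePoint hX]
    have h2 := (abs_le_floor_iff hL₀ hε _).mp ((hk i).trans (by exact_mod_cast hA))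
    have h3 : (ε • latticePoint k) i = ε * k i := rfl
    rw [h3]
    linarith

theorem mulBound_interpSymbol_zero {ftilde ϑ : Freq → ℝ} {X t M : ℝ} (hX : 0 < X) (ε : ℝ)
    (hM : DerivBound 3 M Set.univ (fun z => ϑ z * Real.exp (-(t * X ^ 2 * ‖z‖ ^ 2)))) {A : ℕ}
    {P c : ℝ} (hP0 : 0 ≤ P) (hc : 0 ≤ c)
    (hP : ∀ (i : Fin 3) (a : ℤ) (n : ℕ), n ≤ 2 * A + 1 →
      MulBound (fun k => if a ≤ k i ∧ k i < a + n then 1 else 0) P) (hAc : 2 * A * X⁻¹ ≤ c) :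
    MulBound (interpSymbol ftilde ϑ X ε t A 0) ((P * (1 + c)) ^ 3 * M) :=
  (MulBound.of_derivBound hP0 hc (inv_pos.mpr hX).le hP hAc hM fun _ _ => Set.mem_univ _).congr
    (interpSymbol_zero ftilde ϑ X ε t A)

/-- Returns from `εX` and `tX²` to `ε`, `t` and `X`; the loss `X^(3κ')` of the three projections
fits into `X^κ` because `X ≥ 1`. -/
theorem block_constant_le {C ρ c κ' κ η δ ε t X : ℝ} (hC : 0 ≤ C) (hρ : 0 ≤ ρ) (hc : 0 ≤ c)
    (hκ : 3 * κ' ≤ κ) (hε : 0 < ε) (ht : 0 < t) (hX : 1 ≤ X) :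
    (C * (ρ * X) ^ κ' * (1 + c)) ^ 3 * ((ε * X) ^ η * (t * X ^ 2) ^ (-δ / 2)) ≤
      (C * ρ ^ κ' * (1 + c)) ^ 3 * (ε ^ η * t ^ (-δ / 2) * X ^ (η - δ + κ)) := by
  have hX0 : 0 < X := by linarith
  have h1 : (C * (ρ * X) ^ κ' * (1 + c)) ^ 3 = (C * ρ ^ κ' * (1 + c)) ^ 3 * X ^ (3 * κ') := by
    have : X ^ (3 * κ') = (X ^ κ') ^ 3 := by
      rw [← Real.rpow_natCast, ← Real.rpow_mul hX0.le, mul_comm]; norm_num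
    rw [this, Real.mul_rpow hρ hX0.le]
    ring
  have h2 : (t * X ^ 2) ^ (-δ / 2) = t ^ (-δ / 2) * X ^ (-δ) := by
    rw [Real.mul_rpow ht.le (by positivity), ← Real.rpow_natCast, ← Real.rpow_mul hX0.le]
    congr 2
    push_cast; ring
  have h3 : X ^ (3 * κ') * X ^ η * X ^ (-δ) ≤ X ^ (η - δ + κ) := by
    rw [← Real.rpow_add hX0, ← Real.rpow_add hX0]
    exact Real.rpow_le_rpow_of_exponent_le hX (by linarith)
  rw [h1, h2, Real.mul_rpow hε.le hX0.le]
  calc _ = (C * ρ ^ κ' * (1 + c)) ^ 3 * (ε ^ η * t ^ (-δ / 2)) *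
        (X ^ (3 * κ') * X ^ η * X ^ (-δ)) := by ring
    _ ≤ (C * ρ ^ κ' * (1 + c)) ^ 3 * (ε ^ η * t ^ (-δ / 2)) * X ^ (η - δ + κ) := by gcongr
    _ = _ := by ring

/-- The multiplier norm of `P_t^ε - P_t` localised on a dyadic annulus. -/
theorem exists_mulBound_symbolDiff {L₀ : ℝ} {ftilde : Freq → ℝ} (hL₀ : 0 < L₀)
    (hf : IsAdmissible L₀ ftilde) {ϑ : Freq → ℝ} (hϑ : ContDiff ℝ ∞ ϑ) {r R : ℝ} (hr : 0 < r)
    (hR : 0 ≤ R) (hs : tsupport ϑ ⊆ {z | r ≤ ‖z‖ ∧ ‖z‖ ≤ R}) {δ η κ : ℝ} (hδ : 0 ≤ δ)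
    (hη : 0 < η) (hη' : η < 1) (hκ : 0 < κ) :
    ∃ C : ℝ, 0 < C ∧ ∀ ε t X : ℝ, 0 < ε → 0 < t → 1 ≤ X →
      MulBound (fun k => ϑ (X⁻¹ • latticePoint k) * symbolDiff L₀ ftilde ε t k)
        (C * (ε ^ η * t ^ (-δ / 2) * X ^ (η - δ + κ))) := by
  obtain ⟨κ', hκ0, hκ1, hκ3⟩ : ∃ κ' : ℝ, 0 < κ' ∧ κ' < 1 ∧ 3 * κ' ≤ κ :=
    ⟨min (κ / 3) (1 / 2), by positivity, (min_le_right _ _).trans_lt (by norm_num),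
      by linarith [min_le_left (κ / 3) (1 / 2)]⟩
  obtain ⟨C₁, hC₁, hint⟩ := exists_mulBound_interval hκ0 hκ1
  obtain ⟨C₂, hC₂, hheat⟩ := exists_derivBound_heat hϑ hr hs hδ
  obtain ⟨C₃, hC₃, hinterp⟩ := exists_derivBound_interpolation hL₀ hf hϑ hr hs hδ hη'
  have hE0 : 0 < (L₀ / (R + 1)) ^ η := by positivity
  refine ⟨(C₃ + 2 * C₂ * ((L₀ / (R + 1)) ^ η)⁻¹) *
    (C₁ * (2 * R + 3) ^ κ' * (1 + (2 * R + 2))) ^ 3, by positivity, fun ε t X hε ht hX => ?_⟩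
  have hX0 : 0 < X := by linarith
  -- The smallest integer box covering the support of the block; its size is comparable to `X`,
  -- which keeps the variation constant `2A/X` bounded.
  obtain ⟨A, hA⟩ : ∃ A, A = ⌈R * X⌉₊ := ⟨_, rfl⟩
  have hA1 : R * X ≤ A := hA ▸ Nat.le_ceil _
  have hA2 : (A : ℝ) ≤ R * X + 1 := hA ▸ (Nat.ceil_lt_add_one (by positivity)).le
  clear hA
  have hint' : ∀ (i : Fin 3) (a : ℤ) (n : ℕ), n ≤ 2 * A + 1 → MulBound
      (fun k => if a ≤ k i ∧ k i < a + n then 1 else 0) (C₁ * ((2 * R + 3) * X) ^ κ') := by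
    intro i a n hn
    refine (hint i a n).mono ?_
    have : (n : ℝ) ≤ 2 * A + 1 := by exact_mod_cast hn
    gcongr
    nlinarith
  have hmin : ((min ⌊L₀ / ε⌋₊ A : ℕ) : ℝ) ≤ A := by exact_mod_cast min_le_right _ _
  have hint'' : ∀ (i : Fin 3) (a : ℤ) (n : ℕ), n ≤ 2 * min ⌊L₀ / ε⌋₊ A + 1 → MulBound
      (fun k => if a ≤ k i ∧ k i < a + n then 1 else 0) (C₁ * ((2 * R + 3) * X) ^ κ') :=
    fun i a n hn => hint' i a n (hn.trans (by have := min_le_right ⌊L₀ / ε⌋₊ A; omega))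
  have hAc : 2 * (A : ℝ) * X⁻¹ ≤ 2 * R + 2 := by
    rw [← div_eq_mul_inv, div_le_iff₀ hX0]
    nlinarith
  have hAc' : 2 * ((min ⌊L₀ / ε⌋₊ A : ℕ) : ℝ) * X⁻¹ ≤ 2 * R + 2 :=
    le_trans (by gcongr) hAc
  have hP0 : 0 ≤ C₁ * ((2 * R + 3) * X) ^ κ' := by positivity
  have hc0 : 0 ≤ 2 * R + 2 := by positivity
  have hT0 : 0 < t * X ^ 2 := by positivity
  have he0 : 0 < ε * X := by positivity
  have hm01 := mulBound_interpSymbol_sub hL₀ hX0 hε (fun s => hinterp (ε * X) (t * X ^ 2) s he0 hT0)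
    (min_le_left _ A) hP0 hc0 hint'' hAc'
  have hcomp := block_constant_le (δ := δ) (η := η) (κ := κ) (κ' := κ') hC₁.le
    (by positivity : 0 ≤ 2 * R + 3) hc0 hκ3 hε ht hX
  obtain ⟨Y, hY⟩ : ∃ Y, Y = (C₁ * ((2 * R + 3) * X) ^ κ' * (1 + (2 * R + 2))) ^ 3 := ⟨_, rfl⟩
  have hY0 : 0 ≤ Y := hY ▸ by positivity
  have hid := mul_symbolDiff_eq hL₀ (fun z hz => (hs hz).2) hX0 hε t hA1 (ftilde := ftilde)
  have hgoal : (C₃ + 2 * C₂ * ((L₀ / (R + 1)) ^ η)⁻¹) *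
      (Y * ((ε * X) ^ η * (t * X ^ 2) ^ (-δ / 2))) ≤
      (C₃ + 2 * C₂ * ((L₀ / (R + 1)) ^ η)⁻¹) *
        (C₁ * (2 * R + 3) ^ κ' * (1 + (2 * R + 2))) ^ 3 *
        (ε ^ η * t ^ (-δ / 2) * X ^ (η - δ + κ)) := by
    rw [mul_assoc _ (_ ^ 3), hY]
    exact mul_le_mul_of_nonneg_left hcomp (by positivity)
  rw [← hY] at hm01
  -- Either the box of the block lies inside the cutoff cube, and interpolation alone suffices, or
  -- the cube cuts the box and `εX ≥ L₀/(R + 1)`.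
  rcases le_or_gt A ⌊L₀ / ε⌋₊ with hle | hlt
  · refine (hm01.mono (le_trans ?_ hgoal)).congr fun k => ?_
    · rw [mul_left_comm]
      exact mul_le_mul_of_nonneg_right (le_add_of_nonneg_right (by positivity)) (by positivity)
    · rw [hid, min_eq_right hle]
  · have heE : L₀ / (R + 1) ≤ ε * X := by
      have h1 : L₀ / ε < A := (Nat.floor_lt (by positivity)).mp hlt
      have h2 : L₀ / ε ≤ (R + 1) * X := by nlinarith
      rw [div_le_iff₀ hε] at h2
      rw [div_le_iff₀ (by positivity)]
      linarith
    have hT1 : (t * X ^ 2) ^ (-δ / 2) ≤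
        ((L₀ / (R + 1)) ^ η)⁻¹ * ((ε * X) ^ η * (t * X ^ 2) ^ (-δ / 2)) := by
      rw [← mul_assoc]
      refine le_mul_of_one_le_left (by positivity) ?_
      rw [← div_eq_inv_mul, one_le_div hE0]
      gcongr
    have hb := mulBound_interpSymbol_zero (ftilde := ftilde) hX0 ε (hheat _ hT0) hP0 hc0 hint'' hAc'
    have hb' := mulBound_interpSymbol_zero (ftilde := ftilde) hX0 ε (hheat _ hT0) hP0 hc0 hint' hAc
    rw [← hY] at hb hb'
    -- The heat symbol on the smaller box is added and subtracted: interpolation is used only inside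
    -- the cube, and both heat terms are controlled by `hT1`.
    refine ((hm01.add (hb.sub hb')).mono (le_trans ?_ hgoal)).congr fun k => ?_
    · have := mul_le_mul_of_nonneg_left hT1 (by positivity : 0 ≤ 2 * C₂ * Y)
      linarith
    · rw [hid]
      ring

/-! ### The Littlewood-Paley blocks -/

variable {χ θ : Freq → ℝ}

theorem one_le_norm_latticePoint {k : Fin 3 → ℤ} (hk : k ≠ 0) : 1 ≤ ‖latticePoint k‖ := by
  obtain ⟨i, hi⟩ := Function.ne_iff.mp hk
  have h1 : (1 : ℝ) ≤ |(k i : ℝ)| := by exact_mod_cast Int.one_le_abs hi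
  refine h1.trans ?_
  simpa [latticePoint] using PiLp.norm_apply_le (latticePoint k) i

/-- A function of compact support can be changed near the origin without affecting the values at
the nonzero lattice points. -/
theorem exists_annulus_cutoff (hχ : ContDiff ℝ ∞ χ) {R : ℝ} (hR : tsupport χ ⊆ {z | ‖z‖ ≤ R}) :
    ∃ ϑ : Freq → ℝ, ContDiff ℝ ∞ ϑ ∧ tsupport ϑ ⊆ {z | 1 / 4 ≤ ‖z‖ ∧ ‖z‖ ≤ R} ∧
      ∀ z, 1 ≤ ‖z‖ → ϑ z = χ z := by
  let b : ContDiffBump (0 : Freq) := ⟨1 / 4, 1 / 2, by norm_num, by norm_num⟩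
  refine ⟨fun z => χ z * (1 - b z), hχ.mul (contDiff_const.sub b.contDiff), fun z hz => ⟨?_, ?_⟩,
    fun z hz => ?_⟩
  · have h1 : tsupport (fun z => χ z * (1 - b z)) ⊆ {z | 1 / 4 ≤ ‖z‖} := by
      refine closure_minimal (fun y hy => ?_) (isClosed_le continuous_const continuous_norm)
      by_contra h
      refine hy ?_
      have hb : b y = 1 := b.one_of_mem_closedBall (by simpa using (not_le.mp h).le)
      simp [hb]
    exact h1 hz
  · exact hR (tsupport_mul_subset_left hz)
  · have hb : b z = 0 := b.zero_of_le_dist (by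
      rw [dist_zero_right]
      exact le_trans (by norm_num) hz)
    simp [hb]

/-- Blocks with cutoff `θ(2^(-j) ·)` are handled at scale `X = 2^j`. The cutoff `χ` does not fit
into an annulus, but the symbol difference vanishes at `k = 0` and all other lattice points have
norm at least 1, so `χ` may be altered near the origin. -/
theorem IsDyadicPartition.exists_mulBound (hχθ : IsDyadicPartition χ θ) {L₀ : ℝ}
    {ftilde : Freq → ℝ} (hL₀ : 0 < L₀) (hf : IsAdmissible L₀ ftilde) {δ η κ : ℝ} (hδ : 0 ≤ δ)
    (hη : 0 < η) (hη' : η < 1) (hκ : 0 < κ) :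
    ∃ C : ℝ, 0 < C ∧ ∀ ε t : ℝ, 0 < ε → 0 < t → ∀ n : ℕ,
      MulBound (fun k => lpCutoff χ θ n (latticePoint k) * symbolDiff L₀ ftilde ε t k)
        (C * (ε ^ η * t ^ (-δ / 2) * (2 : ℝ) ^ (((n : ℝ) - 1) * (η - δ + κ)))) := by
  obtain ⟨r, R, hr, hR⟩ := hχθ.theta_support
  obtain ⟨R', hR'⟩ := hχθ.chi_support
  have hmono : ∀ (ϑ : Freq → ℝ) (r R : ℝ), tsupport ϑ ⊆ {z | r ≤ ‖z‖ ∧ ‖z‖ ≤ R} →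
      tsupport ϑ ⊆ {z | r ≤ ‖z‖ ∧ ‖z‖ ≤ |R|} := fun ϑ r R h z hz =>
    ⟨(h hz).1, (h hz).2.trans (le_abs_self R)⟩
  obtain ⟨ϑ, hϑ, hϑs, hϑe⟩ := exists_annulus_cutoff hχθ.contDiff_chi hR'
  obtain ⟨C₁, hC₁, h₁⟩ := exists_mulBound_symbolDiff hL₀ hf hχθ.contDiff_theta hr (abs_nonneg R)
    (hmono _ _ _ hR) hδ hη hη' hκ
  obtain ⟨C₂, hC₂, h₂⟩ := exists_mulBound_symbolDiff hL₀ hf hϑ (by norm_num) (abs_nonneg R')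
    (hmono _ _ _ hϑs) hδ hη hη' hκ
  refine ⟨C₁ + C₂ * (2 : ℝ) ^ (η - δ + κ), by positivity, fun ε t hε ht n => ?_⟩
  cases n with
  | zero =>
    refine ((h₂ ε t 1 hε ht le_rfl).mono ?_).congr fun k => ?_
    · have e : (2 : ℝ) ^ (η - δ + κ) * (2 : ℝ) ^ ((((0 : ℕ) : ℝ) - 1) * (η - δ + κ)) = 1 := by
        rw [← Real.rpow_add two_pos]
        simp
      rw [Real.one_rpow, add_mul]
      refine le_add_of_nonneg_of_le (by positivity) (le_of_eq ?_)
      calc C₂ * (ε ^ η * t ^ (-δ / 2) * 1) = C₂ * (ε ^ η * t ^ (-δ / 2) *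
            ((2 : ℝ) ^ (η - δ + κ) * (2 : ℝ) ^ ((((0 : ℕ) : ℝ) - 1) * (η - δ + κ)))) := by rw [e]
        _ = _ := by ring
    · rw [inv_one, one_smul]
      rcases eq_or_ne k 0 with rfl | hk
      · rw [symbolDiff_zero hL₀]; simp
      · rw [hϑe _ (one_le_norm_latticePoint hk)]; rfl
  | succ j =>
    refine (h₁ ε t ((2 : ℝ) ^ j) hε ht (one_le_pow₀ (by norm_num))).mono ?_
    have e : ((2 : ℝ) ^ j) ^ (η - δ + κ) = (2 : ℝ) ^ ((((j + 1 : ℕ) : ℝ) - 1) * (η - δ + κ)) := by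
      rw [← Real.rpow_natCast, ← Real.rpow_mul two_pos.le]
      congr 2
      push_cast; ring
    rw [e]
    exact mul_le_mul_of_nonneg_right (le_add_of_nonneg_right (by positivity)) (by positivity)

theorem IsDyadicPartition.lpCutoff_eq_zero (hχθ : IsDyadicPartition χ θ) {m n : ℕ}
    (hmn : m + 1 < n) (z : Freq) (hz : lpCutoff χ θ n z ≠ 0) : lpCutoff χ θ m z = 0 := by
  by_contra h
  obtain ⟨j, rfl⟩ : ∃ j, n = j + 1 := ⟨n - 1, by omega⟩
  have hj := subset_tsupport (fun z => θ (((2 : ℝ) ^ j)⁻¹ • z)) hz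
  cases m with
  | zero =>
    exact Set.disjoint_left.mp (hχθ.chi_disjoint j (by omega)) (subset_tsupport _ h) hj
  | succ i =>
    exact Set.disjoint_left.mp (hχθ.theta_disjoint i j (by omega))
      (subset_tsupport (fun z => θ (((2 : ℝ) ^ i)⁻¹ • z)) h) hj

/-- The neighbouring cutoffs sum up to one on the support of a cutoff. -/
theorem IsDyadicPartition.lpCutoff_mul_sum (hχθ : IsDyadicPartition χ θ) (n : ℕ) (z : Freq) :
    lpCutoff χ θ n z * ∑ m ∈ Finset.Icc (n - 1) (n + 1), lpCutoff χ θ m z =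
      lpCutoff χ θ n z := by
  by_cases hz : lpCutoff χ θ n z = 0
  · rw [hz, zero_mul]
  have h0 : ∀ m, m ∉ Finset.Icc (n - 1) (n + 1) → lpCutoff χ θ m z = 0 := fun m hm => by
    rw [Finset.mem_Icc, not_and_or, not_le, not_le] at hm
    by_contra h
    rcases hm with hm | hm
    · exact h (hχθ.lpCutoff_eq_zero (by omega) z hz)
    · exact hz (hχθ.lpCutoff_eq_zero (by omega) z h)
  have h1 := hχθ.sum_eq_one z
  have h2 : ∑' j : ℕ, θ (((2 : ℝ) ^ j)⁻¹ • z) =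
      ∑ j ∈ Finset.range (n + 1), lpCutoff χ θ (j + 1) z := by
    refine tsum_eq_sum fun j hj => h0 (j + 1) ?_
    rw [Finset.mem_range] at hj
    rw [Finset.mem_Icc]
    omega
  have h3 : ∑ m ∈ Finset.range (n + 2), lpCutoff χ θ m z = 1 := by
    rw [Finset.sum_range_succ', ← h2, ← h1, add_comm]
    rfl
  rw [Finset.sum_subset (s₂ := Finset.range (n + 2)) (fun m hm => by
    rw [Finset.mem_Icc] at hm; rw [Finset.mem_range]; omega) (fun m _ hm => h0 m hm), h3, mul_one]

theorem finite_latticePoint_norm_le (R : ℝ) : {k : Fin 3 → ℤ | ‖latticePoint k‖ ≤ R}.Finite := by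
  refine (Set.finite_Icc (fun _ : Fin 3 => -⌈R⌉) (fun _ => ⌈R⌉)).subset fun k hk => ?_
  have h : ∀ i, |k i| ≤ ⌈R⌉ := fun i => by
    have h2 : |(k i : ℝ)| ≤ ‖latticePoint k‖ := by
      simpa [latticePoint] using PiLp.norm_apply_le (latticePoint k) i
    have h3 : |(k i : ℝ)| ≤ (⌈R⌉ : ℝ) := (h2.trans hk).trans (Int.le_ceil R)
    exact_mod_cast h3
  exact ⟨fun i => (abs_le.mp (h i)).1, fun i => (abs_le.mp (h i)).2⟩

theorem IsDyadicPartition.finite_lpCutoff (hχθ : IsDyadicPartition χ θ) (n : ℕ) :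
    {k : Fin 3 → ℤ | lpCutoff χ θ n (latticePoint k) ≠ 0}.Finite := by
  cases n with
  | zero =>
    obtain ⟨R, hR⟩ := hχθ.chi_support
    exact (finite_latticePoint_norm_le R).subset fun k hk => hR (subset_tsupport _ hk)
  | succ j =>
    obtain ⟨r, R, -, hR⟩ := hχθ.theta_support
    refine (finite_latticePoint_norm_le ((2 : ℝ) ^ j * R)).subset fun k hk => ?_
    have h := (hR (subset_tsupport _ hk)).2
    rwa [norm_smul, Real.norm_of_nonneg (by positivity), inv_mul_le_iff₀ (by positivity)] at h

theorem lpBlock_eq_sum {n : ℕ} {s : Finset (Fin 3 → ℤ)}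
    (hs : ∀ k, lpCutoff χ θ n (latticePoint k) ≠ 0 → k ∈ s) (u : Distribution) (x : Fin 3 → ℝ) :
    lpBlock χ θ n u x =
      ∑ k ∈ s, (lpCutoff χ θ n (latticePoint k) : ℂ) * fourierCoeff u k * expFun k x :=
  tsum_eq_sum fun k hk => by
    rw [not_not.mp fun h => hk (hs k h)]; simp

/-- A multiplier acting on a block is bounded by the neighbouring blocks. -/
theorem IsDyadicPartition.norm_lpBlock_le (hχθ : IsDyadicPartition χ θ) {n : ℕ}
    {m : (Fin 3 → ℤ) → ℝ} {Λ : ℝ}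
    (hm : MulBound (fun k => lpCutoff χ θ n (latticePoint k) * m k) Λ) {u v : Distribution}
    (hv : ∀ k, fourierCoeff v k = (m k : ℂ) * fourierCoeff u k) {b : ℕ → ℝ}
    (hb : ∀ l x, ‖lpBlock χ θ l u x‖ ≤ b l) (x : Fin 3 → ℝ) :
    ‖lpBlock χ θ n v x‖ ≤ Λ * ∑ l ∈ Finset.Icc (n - 1) (n + 1), b l := by
  obtain ⟨s, hs⟩ : ∃ s : Finset (Fin 3 → ℤ), ∀ l ∈ Finset.Icc (n - 1) (n + 1), ∀ k,
      lpCutoff χ θ l (latticePoint k) ≠ 0 → k ∈ s :=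
    ⟨(Finset.Icc (n - 1) (n + 1)).biUnion fun l => (hχθ.finite_lpCutoff l).toFinset,
      fun l hl k hk => Finset.mem_biUnion.mpr ⟨l, hl, by simpa using hk⟩⟩
  -- Coefficients of the sum of the neighbouring blocks of `u`; the cutoff of index `n` does not
  -- distinguish them from those of `u` itself.
  set c : (Fin 3 → ℤ) → ℂ := fun k =>
    ((∑ l ∈ Finset.Icc (n - 1) (n + 1), lpCutoff χ θ l (latticePoint k) : ℝ) : ℂ) *
      fourierCoeff u k with hc
  have h1 : ∀ y, ‖∑ k ∈ s, c k * expFun k y‖ ≤ ∑ l ∈ Finset.Icc (n - 1) (n + 1), b l := by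
    intro y
    have e : ∑ k ∈ s, c k * expFun k y =
        ∑ l ∈ Finset.Icc (n - 1) (n + 1), lpBlock χ θ l u y := by
      rw [Finset.sum_congr rfl fun l hl => lpBlock_eq_sum (hs l hl) u y, Finset.sum_comm]
      refine Finset.sum_congr rfl fun k _ => ?_
      rw [hc]
      push_cast
      rw [Finset.sum_mul, Finset.sum_mul]
    rw [e]
    exact norm_sum_le_of_le _ fun l _ => hb l y
  refine le_of_eq_of_le (congrArg norm ?_) (hm s c _ h1 x)
  rw [lpBlock_eq_sum (hs n (Finset.mem_Icc.mpr ⟨by omega, by omega⟩))]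
  refine Finset.sum_congr rfl fun k _ => ?_
  rw [hv, hc]
  have := hχθ.lpCutoff_mul_sum n (latticePoint k)
  simp only
  nth_rw 1 [← this]
  push_cast; ring

theorem sum_Icc_rpow_le (β : ℝ) (n : ℕ) :
    ∑ l ∈ Finset.Icc (n - 1) (n + 1), (2 : ℝ) ^ (-(((l : ℝ) - 1) * β)) ≤
      3 * (2 : ℝ) ^ |β| * (2 : ℝ) ^ (-(((n : ℝ) - 1) * β)) := by
  have h : ∀ l ∈ Finset.Icc (n - 1) (n + 1), (2 : ℝ) ^ (-(((l : ℝ) - 1) * β)) ≤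
      (2 : ℝ) ^ |β| * (2 : ℝ) ^ (-(((n : ℝ) - 1) * β)) := fun l hl => by
    rw [Finset.mem_Icc] at hl
    rw [← Real.rpow_add two_pos]
    refine Real.rpow_le_rpow_of_exponent_le one_le_two ?_
    have h1 : |(n : ℝ) - l| ≤ 1 := by
      have h2 : (n : ℝ) ≤ l + 1 := by exact_mod_cast (by omega : n ≤ l + 1)
      have h3 : (l : ℝ) ≤ n + 1 := by exact_mod_cast hl.2
      rw [abs_le]
      constructor <;> linarith
    have h2 : ((n : ℝ) - l) * β ≤ |β| := by
      calc _ ≤ |((n : ℝ) - l) * β| := le_abs_self _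
        _ = |(n : ℝ) - l| * |β| := abs_mul _ _
        _ ≤ _ := mul_le_of_le_one_left (abs_nonneg _) h1
    linarith
  refine (Finset.sum_le_card_nsmul _ _ _ h).trans ?_
  rw [nsmul_eq_mul, mul_assoc]
  refine mul_le_mul_of_nonneg_right ?_ (by positivity)
  -- Three neighbours, or two when `n = 0`, since `n - 1` is then truncated to 0.
  rw [Nat.card_Icc]
  exact_mod_cast (by omega : n + 1 + 1 - (n - 1) ≤ 3)

end
end TorusBesov

/-! ### Summing up: from block bounds to the Hölder-Besov norm -/

open scoped ENNReal in
theorem lemma3p3 (χ θ : TorusBesov.Freq → ℝ) (hχθ : TorusBesov.IsDyadicPartition χ θ)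
    (L₀ : ℝ) (hL₀ : 0 < L₀) (ftilde : TorusBesov.Freq → ℝ)
    (hf : TorusBesov.IsAdmissible L₀ ftilde)
    (d : ℕ) (α η δ κ : ℝ) (hη₀ : 0 < η) (hη₁ : η < 1) (hδ : 0 ≤ δ) (hκ : 0 < κ) :
    ∃ C : ℝ, 0 < C ∧ ∀ ε : ℝ, 0 < ε → ε < 1 → ∀ t : ℝ, 0 < t →
      ∀ u : Fin d → TorusBesov.Distribution,
        TorusBesov.besovNorm χ θ (α + η) u < ⊤ →
        TorusBesov.besovNorm χ θ (α + δ - κ)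
            (fun i => TorusBesov.approxHeat L₀ ftilde ε t (u i) - TorusBesov.heat t (u i)) ≤
          ENNReal.ofReal (C * ε ^ η * t ^ (-δ / 2)) * TorusBesov.besovNorm χ θ (α + η) u := by
  obtain ⟨C, hC, hmul⟩ := hχθ.exists_mulBound hL₀ hf hδ hη₀ hη₁ hκ
  refine ⟨C * (3 * (2 : ℝ) ^ |α + η|), by positivity, fun ε hε _ t ht u hu => ?_⟩
  unfold TorusBesov.besovNorm at hu ⊢
  rw [Finset.mul_sum]
  refine Finset.sum_le_sum fun i _ => ?_
  have hSi := (Finset.single_le_sum (f := fun i => ⨆ n : ℕ,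
    ENNReal.ofReal ((2 : ℝ) ^ (((n : ℝ) - 1) * (α + η))) *
      ⨆ x, ‖TorusBesov.lpBlock χ θ n (u i) x‖ₑ) (fun _ _ => zero_le) (Finset.mem_univ i)).trans_lt hu
  obtain ⟨S, hS⟩ : ∃ S : ℝ≥0∞, S = ⨆ n : ℕ,
    ENNReal.ofReal ((2 : ℝ) ^ (((n : ℝ) - 1) * (α + η))) *
      ⨆ x, ‖TorusBesov.lpBlock χ θ n (u i) x‖ₑ := ⟨_, rfl⟩
  simp only [← hS] at hSi ⊢
  -- Finiteness of the norm turns the supremum in `[0, ∞]` into real decay of the blocks of `u i`.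
  have hb : ∀ (n : ℕ) x, ‖TorusBesov.lpBlock χ θ n (u i) x‖ ≤
      (2 : ℝ) ^ (-(((n : ℝ) - 1) * (α + η))) * S.toReal := by
    intro n x
    have h1 : ENNReal.ofReal ((2 : ℝ) ^ (((n : ℝ) - 1) * (α + η))) *
        ‖TorusBesov.lpBlock χ θ n (u i) x‖ₑ ≤ S := by
      rw [hS]
      exact le_iSup_of_le n (mul_le_mul_right (le_iSup
        (fun x => ‖TorusBesov.lpBlock χ θ n (u i) x‖ₑ) x) _)
    have h2 := ENNReal.toReal_mono hSi.ne h1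
    rw [ENNReal.toReal_mul, ENNReal.toReal_ofReal (by positivity), toReal_enorm] at h2
    rwa [Real.rpow_neg two_pos.le, ← div_eq_inv_mul, le_div_iff₀' (by positivity)]
  refine iSup_le fun n => ?_
  have hblock := hχθ.norm_lpBlock_le (hmul ε t hε ht n)
    (TorusBesov.fourierCoeff_approxHeat_sub_heat hL₀ hf ε ht (u i)) hb
  rw [← Finset.sum_mul] at hblock
  have hx : ∀ x, ‖TorusBesov.lpBlock χ θ n (TorusBesov.approxHeat L₀ ftilde ε t (u i) -
      TorusBesov.heat t (u i)) x‖ ≤ (2 : ℝ) ^ (-(((n : ℝ) - 1) * (α + δ - κ))) *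
        (C * (3 * (2 : ℝ) ^ |α + η|) * ε ^ η * t ^ (-δ / 2) * S.toReal) := by
    intro x
    refine (hblock x).trans ?_
    -- The growth `η - δ + κ` of the multiplier and the decay `α + η` of the blocks combine to
    -- exactly the claimed regularity.
    have e : (2 : ℝ) ^ (-(((n : ℝ) - 1) * (α + δ - κ))) =
        (2 : ℝ) ^ (((n : ℝ) - 1) * (η - δ + κ)) * (2 : ℝ) ^ (-(((n : ℝ) - 1) * (α + η))) := by
      rw [← Real.rpow_add two_pos]; congr 1; ring
    rw [e]
    calc _ ≤ C * (ε ^ η * t ^ (-δ / 2) * (2 : ℝ) ^ (((n : ℝ) - 1) * (η - δ + κ))) *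
          (3 * (2 : ℝ) ^ |α + η| * (2 : ℝ) ^ (-(((n : ℝ) - 1) * (α + η))) * S.toReal) := by
          gcongr
          exact TorusBesov.sum_Icc_rpow_le _ _
      _ = _ := by ring
  have hsup : ⨆ x, ‖TorusBesov.lpBlock χ θ n (TorusBesov.approxHeat L₀ ftilde ε t (u i) -
      TorusBesov.heat t (u i)) x‖ₑ ≤ ENNReal.ofReal ((2 : ℝ) ^ (-(((n : ℝ) - 1) * (α + δ - κ))) *
        (C * (3 * (2 : ℝ) ^ |α + η|) * ε ^ η * t ^ (-δ / 2) * S.toReal)) := by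
    refine iSup_le fun x => ?_
    rw [← ofReal_norm]
    exact ENNReal.ofReal_le_ofReal (hx x)
  refine (mul_le_mul_right hsup _).trans (le_of_eq ?_)
  rw [← ENNReal.ofReal_mul (by positivity), ← mul_assoc, ← Real.rpow_add two_pos, add_neg_cancel,
    Real.rpow_zero, one_mul, ENNReal.ofReal_mul (by positivity), ENNReal.ofReal_toReal hSi.ne]
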